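/- **Definitions.** Let $V$ be a complex $*$-vector space, $V_h=\{v: v^*=v\}$, and let $M_n(V)$ carry the involution $[v_{ij}]^*=[v_{ji}^*]$. A *local operator system* is a triple $(V,\{\{\mathcal C_\alpha^n\}_{n\ge 1}:\alpha\in\Gamma\},e)$ with $\Gamma\ne\emptyset$, $e\in V_h$ and cones $\mathcal C_\alpha^n\subseteq M_n(V)_h$ (closed under addition and multiplication by nonnegative reals, containing $0$, not necessarily proper) such that: (i) the family is downward filtered, i.e. for all $\alpha,\beta$ there is $\gamma$ with $\mathcal C_\gamma^n\subseteq\mathcal C_\alpha^n\cap\mathcal C_\beta^n$ for all $n$; (ii) $\bigcap_\alpha(\mathcal C_\alpha^n\cap-\mathcal C_\alpha^n)=\{0\}$; (iii) $X^*\mathcal C_\alpha^nX\subseteq\mathcal C_\alpha^m$ for every scalar matrix $X\in M_{n,m}$; (iv) with $e_n=\mathrm{diag}(e,\dots,e)$, for all $\alpha$, $n$ and $A\in M_n(V)_h$ there is $r>0$ with $re_n-A\in\mathcal C_\alpha^n$; (v) if $re_n+A\in\mathcal C_\alpha^n$ for all $r>0$, then $A\in\mathcal C_\alpha^n$. A linear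 map $\phi:V\to M_k$ is *local unital completely positive (LUCP) with respect to $\mathcal C_\alpha$* if $\phi(e)=1$ and $\phi^{(n)}(\mathcal C_\alpha^n)\subseteq M_{nk}^+$ for all $n$. A *quantized domain* in a Hilbert space $H$ is an upward filtered family $\mathcal E=\{H_\alpha\}_{\alpha\in\Gamma}$ of closed subspaces whose union $D$ is dense in $H$. With $P_\alpha$ the projection onto $H_\alpha$, $C^*_{\mathcal E}(D)$ is the unital $*$-algebra of all linear $T:D\to D$ such that, for every $\alpha$, $T(H_\alpha)\subseteq H_\alpha$, $T|_{H_\alpha}$ is bounded and $P_\alpha T\subseteq TP_\alpha$; its involution is the restriction to $D$ of the unbounded adjoint. The local positive cone of $M_n(C^*_{\mathcal E}(D))$ at $\alpha$ consists of the hermitian $A$ with $A|_{H_\alpha^n}\ge 0$. A linear map $i:V\to C^*_{\mathcal E}(D)$ (same index set $\Gamma$) is a *local unital complete order isomorphism onto its range* if it is injective, $i(e)=1$, and for all $\alpha$, $n$ and $A\in M_n(V)$: $A\in\mathcal C_\alpha^n$ if and only if $i^{(n)}(A)$ lies in the local positive cone of $M_n(C^*_{\mathcal E}(D))$ at $\alpha$.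 For quantized domains $\mathcal E=\{H_\alpha\}_{\alpha\in\Gamma}$ in $H$ and $\mathcal G=\{K_\beta\}_{\beta\in\Lambda}$ in $K$, with unions $D$ and $F$, let $\mathcal E\times\mathcal G$ be the quantized domain of the Hilbert space tensor products $H_\alpha\otimes K_\beta$, regarded as closed subspaces of the Hilbert space tensor product $H\otimes K$; its union space is denoted $D\otimes F$. For $S\in C^*_{\mathcal E}(D)$ and $T\in C^*_{\mathcal G}(F)$, $S\otimes T$ is the unique element of $C^*_{\mathcal E\times\mathcal G}(D\otimes F)$ with $(S\otimes T)(x\otimes y)=Sx\otimes Ty$ for $x\in D$, $y\in F$. **Theorem.** Let $(V,\{\{\mathcal C_\alpha^n\}_n:\alpha\in\Gamma\},e_V)$ and $(W,\{\{\mathcal D_\beta^n\}_n:\beta\in\Lambda\},e_W)$ be local operator systems, and let $i_V:V\to C^*_{\mathcal E}(D)$ and $i_W:W\to C^*_{\mathcal G}(F)$ be local unital complete order isomorphisms onto their ranges, where $D=\bigcup_\alpha H_\alpha$ and $F=\bigcup_\beta K_\beta$. For $(\alpha,\beta)\in\Gamma\times\Lambda$ let $$\mathcal T^{n(\mathrm{lmin})}_{(\alpha,\beta)}=\{p\in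 M_n(V\otimes W)_h:\ (\phi\otimes\psi)^{(n)}(p)\in M_{nkm}^+\text{ for all }k,m\text{ and all LUCP }\phi:V\to M_k\text{ w.r.t. }\mathcal C_\alpha,\ \psi:W\to M_m\text{ w.r.t. }\mathcal D_\beta\}.$$ Then: 1. For all $\alpha,\beta,n$ and $p\in M_n(V\otimes W)$: $p\in\mathcal T^{n(\mathrm{lmin})}_{(\alpha,\beta)}$ if and only if $(i_V\otimes i_W)^{(n)}(p)$ is hermitian and its restriction to $(H_\alpha\otimes K_\beta)^n$ is positive. Moreover, $i_V\otimes i_W:V\otimes W\to C^*_{\mathcal E\times\mathcal G}(D\otimes F)$ is $*$-preserving, and it is a local unital complete order isomorphism onto its range with respect to the cones $\mathcal T^{n(\mathrm{lmin})}_{(\alpha,\beta)}$ and the unit $e_V\otimes e_W$. 2. The family $\{\{\mathcal T_\gamma^{n(\mathrm{lmin})}\}_n:\gamma\in\Gamma\times\Lambda\}$ is a local operator system structure on $V\otimes W$: together with the unit $e_V\otimes e_W$ it makes $V\otimes W$ a local operator system; for every $(\alpha,\beta)$ there is $\gamma\in\Gamma\times\Lambda$, and for every $\gamma\in\Gamma\times\Lambda$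 there is $(\alpha,\beta)$, with $\mathcal C_\alpha^n\otimes\mathcal D_\beta^m\subseteq\mathcal T_\gamma^{nm(\mathrm{lmin})}$ for all $n,m$; and $\phi\otimes\psi:V\otimes W\to M_{km}$ is LUCP with respect to $\mathcal T^{(\mathrm{lmin})}_{(\alpha,\beta)}$ whenever $\phi:V\to M_k$ and $\psi:W\to M_m$ are LUCP with respect to $\mathcal C_\alpha$ and $\mathcal D_\beta$. 3. $D\otimes F=\bigcup_{(\alpha,\beta)}H_\alpha\otimes K_\beta$, where the subspace $H_\alpha\otimes K_\beta$ of $H\otimes K$ is isometrically isomorphic, via $x\otimes y\mapsto x\otimes y$, to the Hilbert space tensor product of $H_\alpha$ and $K_\beta$. -/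

import Mathlib

open scoped TensorProduct ComplexOrder InnerProductSpace Kronecker

set_option linter.unusedSectionVars false

namespace LocalOpSys

/-! ## Abstract local operator systems -/

section Abstract

variable {Γ Λ V W : Type*}
  [AddCommGroup V] [Module ℂ V] [StarAddMonoid V] [StarModule ℂ V]
  [AddCommGroup W] [Module ℂ W] [StarAddMonoid W] [StarModule ℂ W]

/-- The product `X* A X`, where `X` is a scalar matrix and `A` is a square matrix over `V`. -/
def conjBy {n m : ℕ} (X : Matrix (Fin n) (Fin m) ℂ) (A : Matrix (Fin n) (Fin n) V) :
    Matrix (Fin m) (Fin m) V :=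
  Matrix.of fun i j => ∑ k, ∑ l, (star (X k i) * X l j) • A k l

/-- `(V, {C_α^n}, e)` is an (abstract) local operator system.  The set `C α n` is the cone `C_α^n`
in `M_n(V)`.  (The level `n = 0` carries no information: there `M_0(V) = {0} = C_α^0`.) -/
structure IsLocalOperatorSystem (C : Γ → ∀ n : ℕ, Set (Matrix (Fin n) (Fin n) V)) (e : V) :
    Prop where
  /-- the index set is nonempty -/
  nonempty : Nonempty Γ
  /-- local positive elements are hermitian -/
  isHermitian : ∀ α n, ∀ A ∈ C α n, A.IsHermitian
  /-- each `C_α^n` is a cone (not necessarily proper) -/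
  zero_mem : ∀ α n, 0 ∈ C α n
  add_mem : ∀ α n, ∀ A ∈ C α n, ∀ B ∈ C α n, A + B ∈ C α n
  smul_mem : ∀ α n, ∀ r : ℝ, 0 ≤ r → ∀ A ∈ C α n, (r : ℂ) • A ∈ C α n
  /-- the family of matrix cones is downward filtered -/
  directed : ∀ α β, ∃ γ, ∀ n, C γ n ⊆ C α n ∩ C β n
  /-- `⋂ α, C_α^n ∩ -C_α^n = {0}` -/
  eq_zero : ∀ n, ∀ A : Matrix (Fin n) (Fin n) V, (∀ α, A ∈ C α n ∧ -A ∈ C α n) → A = 0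
  /-- `X* C_α^n X ⊆ C_α^m` -/
  conj_mem : ∀ α (n m : ℕ) (X : Matrix (Fin n) (Fin m) ℂ), ∀ A ∈ C α n, conjBy X A ∈ C α m
  /-- `e` is hermitian -/
  star_unit : star e = e
  /-- `e_n = diag(e, …, e)` is an order unit of `M_n(V)` -/
  order_unit : ∀ α n, ∀ A : Matrix (Fin n) (Fin n) V, A.IsHermitian →
    ∃ r : ℝ, 0 < r ∧ (r : ℂ) • Matrix.diagonal (fun _ => e) - A ∈ C α n
  /-- the order unit `e_n` is Archimedean -/
  archimedean : ∀ α n, ∀ A : Matrix (Fin n) (Fin n) V,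
    (∀ r : ℝ, 0 < r → (r : ℂ) • Matrix.diagonal (fun _ => e) + A ∈ C α n) → A ∈ C α n

/-- `φ : V → M_ι(ℂ)` is unital and completely positive with respect to the matrix cone `{P n}_n`:
`φ(e) = 1`, and the block matrix `φ⁽ⁿ⁾(A) = (φ(A_ij))_ij` is positive semidefinite for all
`A ∈ P n`. -/
structure IsLUCP {ι : Type*} [Fintype ι] [DecidableEq ι]
    (P : ∀ n : ℕ, Set (Matrix (Fin n) (Fin n) V)) (e : V) (φ : V →ₗ[ℂ] Matrix ι ι ℂ) : Prop where
  map_unit : φ e = 1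
  posSemidef : ∀ n, ∀ A ∈ P n, (Matrix.comp _ _ _ _ _ (A.map φ)).PosSemidef

/-- The map `φ ⊗ ψ : V ⊗ W → M_k ⊗ M_m = M_{k × m}`, with `(φ ⊗ ψ)(v ⊗ w)` the Kronecker product
of `φ v` and `ψ w`. -/
noncomputable def tensorMatrixMap {ι κ : Type*} (φ : V →ₗ[ℂ] Matrix ι ι ℂ)
    (ψ : W →ₗ[ℂ] Matrix κ κ ℂ) : V ⊗[ℂ] W →ₗ[ℂ] Matrix (ι × κ) (ι × κ) ℂ :=
  TensorProduct.lift
    ((Matrix.kroneckerBilinear (R := ℂ) (α := ℂ) (l := ι) (m := ι) (n := κ) (p := κ)).compl₁₂ φ ψ)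

lemma tensorMatrixMap_tmul {ι κ : Type*} (φ : V →ₗ[ℂ] Matrix ι ι ℂ)
    (ψ : W →ₗ[ℂ] Matrix κ κ ℂ) (v : V) (w : W) :
    tensorMatrixMap φ ψ (v ⊗ₜ w) = φ v ⊗ₖ ψ w := rfl

/-- The `lmin` cones on `V ⊗ W`: the hermitian `p ∈ M_n(V ⊗ W)` such that `(φ ⊗ ψ)⁽ⁿ⁾(p) ≥ 0` for
all local unital completely positive `φ : V → M_k` with respect to `C_α`, and `ψ : W → M_m` with
respect to `D_β`. -/
def lminCone (C : Γ → ∀ n : ℕ, Set (Matrix (Fin n) (Fin n) V)) (eV : V)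
    (D : Λ → ∀ n : ℕ, Set (Matrix (Fin n) (Fin n) W)) (eW : W)
    (p : Γ × Λ) (n : ℕ) : Set (Matrix (Fin n) (Fin n) (V ⊗[ℂ] W)) :=
  {A | A.IsHermitian ∧ ∀ (k m : ℕ) (φ : V →ₗ[ℂ] Matrix (Fin k) (Fin k) ℂ)
    (ψ : W →ₗ[ℂ] Matrix (Fin m) (Fin m) ℂ), IsLUCP (C p.1) eV φ → IsLUCP (D p.2) eW ψ →
    (Matrix.comp _ _ _ _ _ (A.map (tensorMatrixMap φ ψ))).PosSemidef}

/-- `P ⊗ Q ∈ M_{nm}(V ⊗ W)` for `P ∈ M_n(V)` and `Q ∈ M_m(W)`. -/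
noncomputable def matrixTensor {n m : ℕ} (P : Matrix (Fin n) (Fin n) V)
    (Q : Matrix (Fin m) (Fin m) W) : Matrix (Fin (n * m)) (Fin (n * m)) (V ⊗[ℂ] W) :=
  Matrix.reindex finProdFinEquiv finProdFinEquiv (P ⊗ₖₜ[ℂ] Q)

/-- A local operator system structure on the tensor product `V ⊗ W` of two local operator systems,
given by matrix cones indexed by `Γ × Λ`. -/
structure IsTensorStructure (C : Γ → ∀ n : ℕ, Set (Matrix (Fin n) (Fin n) V)) (eV : V)
    (D : Λ → ∀ n : ℕ, Set (Matrix (Fin n) (Fin n) W)) (eW : W)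
    (T : Γ × Λ → ∀ n : ℕ, Set (Matrix (Fin n) (Fin n) (V ⊗[ℂ] W))) : Prop where
  isLocalOperatorSystem : IsLocalOperatorSystem T (eV ⊗ₜ[ℂ] eW)
  exists_index : ∀ α β, ∃ γ, ∀ n m, ∀ P ∈ C α n, ∀ Q ∈ D β m, matrixTensor P Q ∈ T γ (n * m)
  exists_factors : ∀ γ, ∃ α β, ∀ n m, ∀ P ∈ C α n, ∀ Q ∈ D β m, matrixTensor P Q ∈ T γ (n * m)
  lucp : ∀ α β (k m : ℕ) (φ : V →ₗ[ℂ] Matrix (Fin k) (Fin k) ℂ)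
    (ψ : W →ₗ[ℂ] Matrix (Fin m) (Fin m) ℂ), IsLUCP (C α) eV φ → IsLUCP (D β) eW ψ →
    IsLUCP (T (α, β)) (eV ⊗ₜ[ℂ] eW) (tensorMatrixMap φ ψ)

end Abstract

/-! ## Quantized domains and the algebra `C*_E(D)` -/

/-- A quantized domain in `H`: an upward filtered family of closed subspaces with dense union. -/
structure QuantizedDomain (Γ H : Type*) [NormedAddCommGroup H] [InnerProductSpace ℂ H] where
  space : Γ → Submodule ℂ H
  isClosed : ∀ α, IsClosed (space α : Set H)
  directed : Directed (· ≤ ·) space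
  dense : Dense (⋃ α, (space α : Set H))

namespace QuantizedDomain

section Single

variable {Γ H : Type*} [NormedAddCommGroup H] [InnerProductSpace ℂ H]

lemma nonempty_index (E : QuantizedDomain Γ H) : Nonempty Γ := by
  obtain ⟨x, hx⟩ := E.dense.nonempty
  obtain ⟨α, -⟩ := Set.mem_iUnion.1 hx
  exact ⟨α⟩

/-- The union space `D = ⋃ α, H_α`. -/
def domain (E : QuantizedDomain Γ H) : Submodule ℂ H := ⨆ α, E.space α

lemma mem_domain_iff (E : QuantizedDomain Γ H) {x : H} : x ∈ E.domain ↔ ∃ α, x ∈ E.space α :=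
  haveI := E.nonempty_index
  Submodule.mem_iSup_of_directed _ E.directed

lemma mem_domain (E : QuantizedDomain Γ H) {α : Γ} {x : H} (hx : x ∈ E.space α) : x ∈ E.domain :=
  E.mem_domain_iff.2 ⟨α, hx⟩

variable [CompleteSpace H]

instance instCompleteSpace (E : QuantizedDomain Γ H) (α : Γ) : CompleteSpace (E.space α) :=
  (E.isClosed α).completeSpace_coe

/-- The projection `P_α` of `H` onto `H_α`. -/
noncomputable def proj (E : QuantizedDomain Γ H) (α : Γ) : H →L[ℂ] H := (E.space α).starProjection

lemma proj_mem (E : QuantizedDomain Γ H) (α : Γ) (x : H) : E.proj α x ∈ E.space α :=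
  Submodule.starProjection_apply_mem _ _

lemma proj_mem_domain (E : QuantizedDomain Γ H) (α : Γ) (x : H) : E.proj α x ∈ E.domain :=
  E.mem_domain (E.proj_mem α x)

lemma proj_eq_self (E : QuantizedDomain Γ H) {α : Γ} {x : H} (hx : x ∈ E.space α) :
    E.proj α x = x :=
  Submodule.starProjection_eq_self_iff.2 hx

lemma inner_proj (E : QuantizedDomain Γ H) (α : Γ) (x y : H) :
    ⟪E.proj α x, y⟫_ℂ = ⟪x, E.proj α y⟫_ℂ :=
  Submodule.inner_starProjection_left_eq_right _ _ _

/-- The algebra `C_E(D)`: linear maps `T : D → D` with `T(H_α) ⊆ H_α` and `T|H_α` bounded,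
for every `α`. -/
def ncAlg (E : QuantizedDomain Γ H) : Subalgebra ℂ (Module.End ℂ E.domain) where
  carrier := {T | ∀ α, (∀ x : E.domain, (x : H) ∈ E.space α → (T x : H) ∈ E.space α) ∧
    ∃ c : ℝ, ∀ x : E.domain, (x : H) ∈ E.space α → ‖T x‖ ≤ c * ‖x‖}
  mul_mem' := by
    intro S T hS hT α
    obtain ⟨hS1, a, ha⟩ := hS α
    obtain ⟨hT1, b, hb⟩ := hT α
    refine ⟨fun x hx => hS1 _ (hT1 _ hx), |a| * b, fun x hx => ?_⟩
    calc ‖S (T x)‖ ≤ a * ‖T x‖ := ha _ (hT1 _ hx)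
      _ ≤ |a| * ‖T x‖ := by gcongr; exact le_abs_self a
      _ ≤ |a| * (b * ‖x‖) := by gcongr; exact hb _ hx
      _ = |a| * b * ‖x‖ := by ring
  add_mem' := by
    intro S T hS hT α
    obtain ⟨hS1, a, ha⟩ := hS α
    obtain ⟨hT1, b, hb⟩ := hT α
    refine ⟨fun x hx => (E.space α).add_mem (hS1 _ hx) (hT1 _ hx), a + b, fun x hx => ?_⟩
    calc ‖S x + T x‖ ≤ ‖S x‖ + ‖T x‖ := norm_add_le _ _
      _ ≤ a * ‖x‖ + b * ‖x‖ := add_le_add (ha _ hx) (hb _ hx)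
      _ = (a + b) * ‖x‖ := by ring
  algebraMap_mem' := by
    intro c α
    refine ⟨fun x hx => (E.space α).smul_mem c hx, ‖c‖, fun x _ => ?_⟩
    exact (norm_smul c x).le

/-- The algebra `C*_E(D)`: those `T ∈ C_E(D)` with `P_α T ⊆ T P_α` for every `α`. -/
noncomputable def starAlg (E : QuantizedDomain Γ H) : Subalgebra ℂ (Module.End ℂ E.domain) :=
  E.ncAlg ⊓
  { carrier := {T | ∀ α, ∀ x : E.domain,
      E.proj α (T x : H) = (T ⟨E.proj α (x : H), E.proj_mem_domain α x⟩ : H)}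
    mul_mem' := by
      intro S T hS hT α x
      rw [Module.End.mul_apply, hS α (T x), Module.End.mul_apply]
      exact congrArg (fun z => (S z : H)) (Subtype.ext (hT α x))
    add_mem' := by
      intro S T hS hT α x
      simp only [LinearMap.add_apply, Submodule.coe_add, map_add, hS α x, hT α x]
    algebraMap_mem' := by
      intro c α x
      simp [Module.algebraMap_end_apply] }

lemma starAlg_mem_space (E : QuantizedDomain Γ H) (T : E.starAlg) {α : Γ} (x : E.domain)
    (hx : (x : H) ∈ E.space α) : ((T : Module.End ℂ E.domain) x : H) ∈ E.space α :=
  (T.2.1 α).1 x hx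

lemma starAlg_bound (E : QuantizedDomain Γ H) (T : E.starAlg) (α : Γ) :
    ∃ c : ℝ, ∀ x : E.domain, (x : H) ∈ E.space α → ‖(T : Module.End ℂ E.domain) x‖ ≤ c * ‖x‖ :=
  (T.2.1 α).2

lemma starAlg_proj (E : QuantizedDomain Γ H) (T : E.starAlg) (α : Γ) (x : E.domain) :
    E.proj α ((T : Module.End ℂ E.domain) x : H) =
      ((T : Module.End ℂ E.domain) ⟨E.proj α (x : H), E.proj_mem_domain α x⟩ : H) :=
  T.2.2 α x

/-- The bounded operator `T P_α` on `H`. -/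
noncomputable def cut (E : QuantizedDomain Γ H) (T : E.starAlg) (α : Γ) : H →L[ℂ] H :=
  LinearMap.mkContinuousOfExistsBound
    { toFun := fun x =>
        ((T : Module.End ℂ E.domain) ⟨E.proj α x, E.proj_mem_domain α x⟩ : H)
      map_add' := fun x y => by
        rw [← Submodule.coe_add, ← map_add]
        congr 3
        exact map_add _ _ _
      map_smul' := fun c x => by
        rw [RingHom.id_apply, ← Submodule.coe_smul, ← map_smul]
        congr 3
        exact map_smul _ _ _ }
    (by
      obtain ⟨c, hc⟩ := E.starAlg_bound T α
      refine ⟨|c| * ‖E.proj α‖, fun x => ?_⟩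
      calc _ ≤ c * ‖E.proj α x‖ := hc ⟨E.proj α x, E.proj_mem_domain α x⟩ (E.proj_mem α x)
        _ ≤ |c| * ‖E.proj α x‖ := by gcongr; exact le_abs_self c
        _ ≤ |c| * (‖E.proj α‖ * ‖x‖) := by gcongr; exact (E.proj α).le_opNorm x
        _ = |c| * ‖E.proj α‖ * ‖x‖ := by ring)

lemma cut_apply (E : QuantizedDomain Γ H) (T : E.starAlg) (α : Γ) (x : H) :
    E.cut T α x = ((T : Module.End ℂ E.domain) ⟨E.proj α x, E.proj_mem_domain α x⟩ : H) := rfl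

lemma cut_of_mem (E : QuantizedDomain Γ H) (T : E.starAlg) {α : Γ} (x : E.domain)
    (hx : (x : H) ∈ E.space α) : E.cut T α x = ((T : Module.End ℂ E.domain) x : H) := by
  rw [cut_apply]
  congr 2
  exact Subtype.ext (E.proj_eq_self hx)

lemma cut_mem (E : QuantizedDomain Γ H) (T : E.starAlg) {α : Γ} {x : H} {β : Γ}
    (hx : x ∈ E.space α) (h : E.space α ≤ E.space β) : E.cut T β x ∈ E.space α := by
  have := E.cut_of_mem T (α := β) ⟨x, E.mem_domain hx⟩ (h hx)
  rw [show E.cut T β x = _ from this]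
  exact E.starAlg_mem_space T _ hx

/-- Two elements of `C*_E(D)` that agree on each `H_α` are equal. -/
lemma starAlg_ext (E : QuantizedDomain Γ H) {S T : E.starAlg}
    (h : ∀ α, ∀ x : E.domain, (x : H) ∈ E.space α →
      ((S : Module.End ℂ E.domain) x : H) = (T : Module.End ℂ E.domain) x) : S = T := by
  refine Subtype.ext (LinearMap.ext fun x => Subtype.ext ?_)
  obtain ⟨α, hα⟩ := E.mem_domain_iff.1 x.2
  exact h α x hα

/-- A compatible family of bounded operators, with a compatible family of adjoints, glues to an
element of `C*_E(D)`. -/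
lemma exists_glue (E : QuantizedDomain Γ H) (B B' : Γ → H →L[ℂ] H)
    (r : Γ → Γ → Prop) (hr : ∀ α β, r α β → E.space α ≤ E.space β)
    (hdir : ∀ α β, ∃ γ, r α γ ∧ r β γ)
    (hadj : ∀ α x y, ⟪B α x, y⟫_ℂ = ⟪x, B' α y⟫_ℂ)
    (hcompat : ∀ α β x, r α β → x ∈ E.space α → B β x = B α x)
    (hmem : ∀ α x, x ∈ E.space α → B α x ∈ E.space α)
    (hmem' : ∀ α β x, r α β → x ∈ E.space α → B' β x ∈ E.space α) :
    ∃ T : E.starAlg, ∀ α, ∀ x : E.domain, (x : H) ∈ E.space α →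
      ((T : Module.End ℂ E.domain) x : H) = B α x := by
  choose idx hidx using fun x : E.domain => E.mem_domain_iff.1 x.2
  have key : ∀ α β x, x ∈ E.space α → x ∈ E.space β → B α x = B β x := by
    intro α β x hα hβ
    obtain ⟨γ, h1, h2⟩ := hdir α β
    rw [← hcompat α γ x h1 hα, ← hcompat β γ x h2 hβ]
  let L : E.domain →ₗ[ℂ] E.domain :=
    { toFun := fun x => ⟨B (idx x) x, E.mem_domain (hmem _ _ (hidx x))⟩
      map_add' := fun x y => by
        refine Subtype.ext ?_
        obtain ⟨γ, h1, h2⟩ := hdir (idx x) (idx y)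
        have hx := hr _ _ h1 (hidx x)
        have hy := hr _ _ h2 (hidx y)
        have hxy : ((x + y : E.domain) : H) ∈ E.space γ := (E.space γ).add_mem hx hy
        change B _ _ = B _ _ + B _ _
        rw [key _ γ _ (hidx _) hx, key _ γ _ (hidx _) hy, key _ γ _ (hidx _) hxy, ← map_add]
        rfl
      map_smul' := fun c x => by
        refine Subtype.ext ?_
        have hcx : ((c • x : E.domain) : H) ∈ E.space (idx x) :=
          (E.space _).smul_mem c (hidx x)
        change B _ _ = c • B _ _
        rw [key _ (idx x) _ (hidx _) hcx, ← map_smul]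
        rfl }
  have hL : ∀ α, ∀ x : E.domain, (x : H) ∈ E.space α → (L x : H) = B α x :=
    fun α x hx => key _ _ _ (hidx x) hx
  refine ⟨⟨L, ⟨fun α => ⟨fun x hx => ?_, ‖B α‖, fun x hx => ?_⟩, fun α x => ?_⟩⟩, hL⟩
  · rw [hL α x hx]
    exact hmem α _ hx
  · change ‖(L x : H)‖ ≤ _
    rw [hL α x hx]
    exact (B α).le_opNorm _
  · obtain ⟨β, h1, h2⟩ := hdir α (idx x)
    have hx : (x : H) ∈ E.space β := hr _ _ h2 (hidx x)
    rw [hL β x hx, hL α ⟨E.proj α x, E.proj_mem_domain α x⟩ (E.proj_mem α x)]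
    refine Submodule.eq_starProjection_of_mem_of_inner_eq_zero (hmem _ _ (E.proj_mem α x)) ?_
    intro w hw
    rw [inner_sub_left, ← hcompat α β _ h1 (E.proj_mem α x), hadj, hadj, inner_proj,
      E.proj_eq_self (hmem' α β w h1 hw), sub_self]

lemma exists_adjoint (E : QuantizedDomain Γ H) (T : E.starAlg) :
    ∃ S : E.starAlg, ∀ x y : E.domain,
      ⟪((T : Module.End ℂ E.domain) x : H), y⟫_ℂ = ⟪(x : H), (S : Module.End ℂ E.domain) y⟫_ℂ := by
  have hproj : ∀ α x, E.proj α (E.cut T α x) = E.cut T α x := fun α x =>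
    E.proj_eq_self (E.starAlg_mem_space T _ (E.proj_mem α x))
  have hcut : ∀ α x, E.cut T α (E.proj α x) = E.cut T α x := by
    intro α x
    simp only [cut_apply]
    congr 2
    exact Subtype.ext (E.proj_eq_self (E.proj_mem α x))
  have hcut2 : ∀ α β x, E.space α ≤ E.space β →
      E.proj α (E.cut T β x) = E.cut T α x := by
    intro α β x h
    rw [cut_apply, starAlg_proj, cut_apply]
    congr 2
    refine Subtype.ext ?_
    refine ext_inner_right ℂ fun z => ?_
    change ⟪E.proj α (E.proj β x), z⟫_ℂ = ⟪E.proj α x, z⟫_ℂ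
    rw [inner_proj, inner_proj, inner_proj, E.proj_eq_self (h (E.proj_mem α z))]
  obtain ⟨S, hS⟩ := E.exists_glue (fun α => (E.cut T α).adjoint) (fun α => E.cut T α)
    (fun α β => E.space α ≤ E.space β) (fun _ _ h => h) E.directed
    (fun α x y => ContinuousLinearMap.adjoint_inner_left _ _ _)
    (fun α β x h hx => by
      refine ext_inner_left ℂ fun y => ?_
      rw [ContinuousLinearMap.adjoint_inner_right, ContinuousLinearMap.adjoint_inner_right,
        ← hcut2 α β y h, inner_proj, E.proj_eq_self hx])
    (fun α x hx => by
      rw [← Submodule.starProjection_eq_self_iff]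
      refine ext_inner_left ℂ fun y => ?_
      change ⟪y, E.proj α _⟫_ℂ = _
      rw [← inner_proj, ContinuousLinearMap.adjoint_inner_right,
        ContinuousLinearMap.adjoint_inner_right, hcut])
    (fun α β x h hx => E.cut_mem T hx h)
  refine ⟨S, fun x y => ?_⟩
  obtain ⟨α, hα⟩ := E.mem_domain_iff.1 x.2
  obtain ⟨β, hβ⟩ := E.mem_domain_iff.1 y.2
  obtain ⟨γ, h1, h2⟩ := E.directed α β
  rw [hS γ y (h2 hβ), ContinuousLinearMap.adjoint_inner_right, E.cut_of_mem T x (h1 hα)]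

/-- The involution of `C*_E(D)`: `T*` is the restriction to `D` of the unbounded adjoint of `T`. -/
noncomputable instance instStar (E : QuantizedDomain Γ H) : Star E.starAlg where
  star T := (E.exists_adjoint T).choose

lemma inner_star (E : QuantizedDomain Γ H) (T : E.starAlg) (x y : E.domain) :
    ⟪((T : Module.End ℂ E.domain) x : H), y⟫_ℂ =
      ⟪(x : H), ((star T : E.starAlg) : Module.End ℂ E.domain) y⟫_ℂ :=
  (E.exists_adjoint T).choose_spec x y

/-- The local positive cone at `α` in `M_n(C*_E(D))`: the hermitian matrices `A` whose restriction
to `H_α^n` is a positive operator, that is, `⟨A ξ, ξ⟩ ≥ 0` for all `ξ ∈ H_α^n`. -/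
def cone (E : QuantizedDomain Γ H) (α : Γ) (n : ℕ) : Set (Matrix (Fin n) (Fin n) E.starAlg) :=
  {A | A.IsHermitian ∧ ∀ ξ : Fin n → E.domain, (∀ i, (ξ i : H) ∈ E.space α) →
    0 ≤ ∑ i, ∑ j, ⟪(ξ i : H), ((A i j : Module.End ℂ E.domain) (ξ j) : H)⟫_ℂ}

end Single

/-! ## The tensor product of quantized domains -/

section Tensor

variable {Γ Λ H K : Type*} [NormedAddCommGroup H] [InnerProductSpace ℂ H]
  [NormedAddCommGroup K] [InnerProductSpace ℂ K]

/-- The Hilbert space tensor product `H ⊗ K`. -/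
abbrev HilbertTensor (H K : Type*) [NormedAddCommGroup H] [InnerProductSpace ℂ H]
    [NormedAddCommGroup K] [InnerProductSpace ℂ K] : Type _ :=
  UniformSpace.Completion (H ⊗[ℂ] K)

/-- The elementary tensor `x ⊗ y` in `H ⊗ K`. -/
noncomputable def htmul (x : H) (y : K) : HilbertTensor H K :=
  UniformSpace.Completion.toComplL (𝕜 := ℂ) (E := H ⊗[ℂ] K) (x ⊗ₜ[ℂ] y)

/-- The Hilbert space tensor product of two subspaces, as a closed subspace of `H ⊗ K`: the closed
span of the elementary tensors. -/
noncomputable def tensorSpace (X : Submodule ℂ H) (Y : Submodule ℂ K) :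
    Submodule ℂ (HilbertTensor H K) :=
  (Submodule.span ℂ {z | ∃ x ∈ X, ∃ y ∈ Y, z = htmul x y}).topologicalClosure

lemma htmul_mem {X : Submodule ℂ H} {Y : Submodule ℂ K} {x : H} {y : K} (hx : x ∈ X)
    (hy : y ∈ Y) : htmul x y ∈ tensorSpace X Y :=
  Submodule.le_topologicalClosure _ (Submodule.subset_span ⟨x, hx, y, hy, rfl⟩)

lemma tensorSpace_mono {X X' : Submodule ℂ H} {Y Y' : Submodule ℂ K} (hX : X ≤ X')
    (hY : Y ≤ Y') : tensorSpace X Y ≤ tensorSpace X' Y' := by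
  refine Submodule.topologicalClosure_mono (Submodule.span_mono ?_)
  rintro _ ⟨x, hx, y, hy, rfl⟩
  exact ⟨x, hX hx, y, hY hy, rfl⟩

/-- To map `tensorSpace X Y` into a closed subspace by a bounded operator, it suffices to check
elementary tensors. -/
lemma tensorSpace_le_of_forall {X : Submodule ℂ H} {Y : Submodule ℂ K}
    {S : Submodule ℂ (HilbertTensor H K)} (hS : IsClosed (S : Set (HilbertTensor H K)))
    (h : ∀ x ∈ X, ∀ y ∈ Y, htmul x y ∈ S) : tensorSpace X Y ≤ S := by
  refine Submodule.topologicalClosure_minimal _ (Submodule.span_le.2 ?_) hS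
  rintro _ ⟨x, hx, y, hy, rfl⟩
  exact h x hx y hy

lemma continuous_htmul : Continuous fun p : H × K => htmul p.1 p.2 := by
  refine (UniformSpace.Completion.toComplL (𝕜 := ℂ) (E := H ⊗[ℂ] K)).continuous.comp ?_
  have hb : IsBoundedBilinearMap ℂ fun p : H × K => p.1 ⊗ₜ[ℂ] p.2 :=
    { add_left := fun x y z => TensorProduct.add_tmul _ _ _
      smul_left := fun c x y => TensorProduct.smul_tmul' _ _ _
      add_right := fun x y z => TensorProduct.tmul_add _ _ _
      smul_right := fun c x y => TensorProduct.tmul_smul _ _ _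
      bound := ⟨1, one_pos, fun x y => by simp⟩ }
  exact hb.continuous

lemma tensorSpace_top_top : tensorSpace (⊤ : Submodule ℂ H) (⊤ : Submodule ℂ K) = ⊤ := by
  refine top_unique fun z _ => ?_
  refine UniformSpace.Completion.induction_on z
    (Submodule.isClosed_topologicalClosure _) fun a => ?_
  induction a with
  | zero => exact Submodule.zero_mem _
  | tmul x y => exact htmul_mem trivial trivial
  | add a b ha hb =>
    rw [UniformSpace.Completion.coe_add]
    exact Submodule.add_mem _ ha hb

lemma mem_tensorSpace_top (z : HilbertTensor H K) :
    z ∈ tensorSpace (⊤ : Submodule ℂ H) (⊤ : Submodule ℂ K) := by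
  rw [tensorSpace_top_top]
  trivial

/-- The quantized domain `E × G` in `H ⊗ K`: the family of the Hilbert space tensor products
`H_α ⊗ K_β`.  Its union space is `D ⊗ F`. -/
noncomputable def tensor (E : QuantizedDomain Γ H) (G : QuantizedDomain Λ K) :
    QuantizedDomain (Γ × Λ) (HilbertTensor H K) where
  space p := tensorSpace (E.space p.1) (G.space p.2)
  isClosed p := Submodule.isClosed_topologicalClosure _
  directed p q := by
    obtain ⟨γ, h1, h2⟩ := E.directed p.1 q.1
    obtain ⟨δ, h3, h4⟩ := G.directed p.2 q.2
    exact ⟨(γ, δ), tensorSpace_mono h1 h3, tensorSpace_mono h2 h4⟩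
  dense := by
    set U : Set (HilbertTensor H K) :=
      ⋃ p : Γ × Λ, (tensorSpace (E.space p.1) (G.space p.2) : Set (HilbertTensor H K))
    have := E.nonempty_index
    have := G.nonempty_index
    let S : Submodule ℂ (HilbertTensor H K) :=
      ⨆ p : Γ × Λ, tensorSpace (E.space p.1) (G.space p.2)
    have hS : (S : Set (HilbertTensor H K)) = U := by
      refine Submodule.coe_iSup_of_directed _ fun p q => ?_
      obtain ⟨γ, h1, h2⟩ := E.directed p.1 q.1
      obtain ⟨δ, h3, h4⟩ := G.directed p.2 q.2
      exact ⟨(γ, δ), tensorSpace_mono h1 h3, tensorSpace_mono h2 h4⟩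
    rw [← hS, Submodule.dense_iff_topologicalClosure_eq_top, ← top_le_iff, ← tensorSpace_top_top]
    refine tensorSpace_le_of_forall (Submodule.isClosed_topologicalClosure _) fun x _ y _ => ?_
    have hd := E.dense.prod G.dense
    refine closure_minimal ?_ (IsClosed.preimage continuous_htmul
      (Submodule.isClosed_topologicalClosure S)) (hd.closure_eq ▸ Set.mem_univ (x, y))
    rintro ⟨a, b⟩ ⟨ha, hb⟩
    obtain ⟨α, hα⟩ := Set.mem_iUnion.1 ha
    obtain ⟨β, hβ⟩ := Set.mem_iUnion.1 hb
    refine Submodule.le_topologicalClosure _ ?_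
    exact Submodule.mem_iSup_of_mem (α, β) (htmul_mem hα hβ)

lemma htmul_mem_domain (E : QuantizedDomain Γ H) (G : QuantizedDomain Λ K) {x : H} {y : K}
    (hx : x ∈ E.domain) (hy : y ∈ G.domain) : htmul x y ∈ (E.tensor G).domain := by
  obtain ⟨α, hα⟩ := E.mem_domain_iff.1 hx
  obtain ⟨β, hβ⟩ := G.mem_domain_iff.1 hy
  exact (E.tensor G).mem_domain (α := (α, β)) (htmul_mem hα hβ)

/-- The bounded operator `A ⊗ B` on `H ⊗ K`. -/
noncomputable def tensorL (A : H →L[ℂ] H) (B : K →L[ℂ] K) :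
    HilbertTensor H K →L[ℂ] HilbertTensor H K :=
  (TensorProduct.mapL A B).completion

lemma tensorL_htmul (A : H →L[ℂ] H) (B : K →L[ℂ] K) (x : H) (y : K) :
    tensorL A B (htmul x y) = htmul (A x) (B y) := by
  change (TensorProduct.mapL A B).completion ((x ⊗ₜ[ℂ] y : H ⊗[ℂ] K) : HilbertTensor H K) = _
  rw [ContinuousLinearMap.completion_apply_coe]
  rfl

lemma inner_htmul (x x' : H) (y y' : K) :
    ⟪htmul x y, htmul x' y'⟫_ℂ = ⟪x, x'⟫_ℂ * ⟪y, y'⟫_ℂ := by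
  change ⟪((x ⊗ₜ[ℂ] y : H ⊗[ℂ] K) : HilbertTensor H K),
    ((x' ⊗ₜ[ℂ] y' : H ⊗[ℂ] K) : HilbertTensor H K)⟫_ℂ = _
  rw [UniformSpace.Completion.inner_coe, TensorProduct.inner_tmul]

/-- Two bounded operators that agree on the elementary tensors of `X ⊗ Y` agree on
`tensorSpace X Y`. -/
lemma eq_on_tensorSpace {X : Submodule ℂ H} {Y : Submodule ℂ K} {M : Type*}
    [NormedAddCommGroup M] [NormedSpace ℂ M]
    {A B : HilbertTensor H K →L[ℂ] M}
    (h : ∀ x ∈ X, ∀ y ∈ Y, A (htmul x y) = B (htmul x y)) {z : HilbertTensor H K}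
    (hz : z ∈ tensorSpace X Y) : A z = B z :=
  tensorSpace_le_of_forall (S := LinearMap.eqLocus (A : HilbertTensor H K →ₗ[ℂ] M) B)
    (isClosed_eq A.continuous B.continuous) h hz

lemma tensorL_inner (A A' : H →L[ℂ] H) (B B' : K →L[ℂ] K)
    (hA : ∀ x y, ⟪A x, y⟫_ℂ = ⟪x, A' y⟫_ℂ) (hB : ∀ x y, ⟪B x, y⟫_ℂ = ⟪x, B' y⟫_ℂ)
    (z w : HilbertTensor H K) : ⟪tensorL A B z, w⟫_ℂ = ⟪z, tensorL A' B' w⟫_ℂ := by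
  have h1 : ∀ x y w, ⟪tensorL A B (htmul x y), w⟫_ℂ = ⟪htmul x y, tensorL A' B' w⟫_ℂ := by
    intro x y w
    refine eq_on_tensorSpace (X := ⊤) (Y := ⊤)
      (A := innerSL ℂ (tensorL A B (htmul x y)))
      (B := (innerSL ℂ (htmul x y)).comp (tensorL A' B'))
      (fun x' _ y' _ => ?_) (mem_tensorSpace_top _)
    simp [tensorL_htmul, inner_htmul, hA, hB]
  rw [← inner_conj_symm, ← inner_conj_symm z]
  congr 1
  refine eq_on_tensorSpace (X := ⊤) (Y := ⊤)
    (A := (innerSL ℂ w).comp (tensorL A B)) (B := innerSL ℂ (tensorL A' B' w))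
    (fun x _ y _ => ?_) (mem_tensorSpace_top _)
  simpa [inner_conj_symm] using congrArg (starRingEnd ℂ) (h1 x y w)

variable [CompleteSpace H] [CompleteSpace K]

lemma inner_cut (E : QuantizedDomain Γ H) (T : E.starAlg) (α : Γ) (x y : H) :
    ⟪E.cut T α x, y⟫_ℂ = ⟪x, E.cut (star T) α y⟫_ℂ := by
  have h : ∀ S : E.starAlg, ∀ x, E.proj α (E.cut S α x) = E.cut S α x := fun S x =>
    E.proj_eq_self (E.starAlg_mem_space S _ (E.proj_mem α x))
  calc ⟪E.cut T α x, y⟫_ℂ = ⟪E.cut T α x, E.proj α y⟫_ℂ := by rw [← inner_proj, h]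
    _ = ⟪E.proj α x, E.cut (star T) α y⟫_ℂ :=
      E.inner_star T ⟨_, E.proj_mem_domain α x⟩ ⟨_, E.proj_mem_domain α y⟩
    _ = ⟪x, E.cut (star T) α y⟫_ℂ := by rw [inner_proj, h]

lemma exists_tensorOp (E : QuantizedDomain Γ H) (G : QuantizedDomain Λ K)
    (S : E.starAlg) (T : G.starAlg) :
    ∃ R : (E.tensor G).starAlg, ∀ (x : E.domain) (y : G.domain),
      ((R : Module.End ℂ (E.tensor G).domain) ⟨htmul x y, htmul_mem_domain E G x.2 y.2⟩ :
          HilbertTensor H K) =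
        htmul ((S : Module.End ℂ E.domain) x : H) ((T : Module.End ℂ G.domain) y : K) := by
  have hmem : ∀ (S : E.starAlg) (T : G.starAlg) (p q : Γ × Λ),
      E.space p.1 ≤ E.space q.1 ∧ G.space p.2 ≤ G.space q.2 →
      ∀ z ∈ tensorSpace (E.space p.1) (G.space p.2),
        tensorL (E.cut S q.1) (G.cut T q.2) z ∈ tensorSpace (E.space p.1) (G.space p.2) := by
    intro S T p q h z hz
    refine tensorSpace_le_of_forall
      (S := (tensorSpace (E.space p.1) (G.space p.2)).comap
        (tensorL (E.cut S q.1) (G.cut T q.2) : HilbertTensor H K →ₗ[ℂ] HilbertTensor H K))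
      (IsClosed.preimage (tensorL (E.cut S q.1) (G.cut T q.2)).continuous
        (Submodule.isClosed_topologicalClosure _)) (fun x hx y hy => ?_) hz
    rw [Submodule.mem_comap, ContinuousLinearMap.coe_coe, tensorL_htmul]
    exact htmul_mem (E.cut_mem S hx h.1) (G.cut_mem T hy h.2)
  obtain ⟨R, hR⟩ := (E.tensor G).exists_glue
    (fun p => tensorL (E.cut S p.1) (G.cut T p.2))
    (fun p => tensorL (E.cut (star S) p.1) (G.cut (star T) p.2))
    (fun p q => E.space p.1 ≤ E.space q.1 ∧ G.space p.2 ≤ G.space q.2)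
    (fun p q h => tensorSpace_mono h.1 h.2)
    (fun p q => by
      obtain ⟨γ, h1, h2⟩ := E.directed p.1 q.1
      obtain ⟨δ, h3, h4⟩ := G.directed p.2 q.2
      exact ⟨(γ, δ), ⟨h1, h3⟩, ⟨h2, h4⟩⟩)
    (fun p => tensorL_inner _ _ _ _ (E.inner_cut S p.1) (G.inner_cut T p.2))
    (fun p q z h hz => by
      refine eq_on_tensorSpace (fun x hx y hy => ?_) hz
      rw [tensorL_htmul, tensorL_htmul]
      congr 1
      · exact (E.cut_of_mem S ⟨x, E.mem_domain hx⟩ (h.1 hx)).trans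
          (E.cut_of_mem S ⟨x, E.mem_domain hx⟩ hx).symm
      · exact (G.cut_of_mem T ⟨y, G.mem_domain hy⟩ (h.2 hy)).trans
          (G.cut_of_mem T ⟨y, G.mem_domain hy⟩ hy).symm)
    (fun p z hz => hmem S T p p ⟨le_rfl, le_rfl⟩ z hz)
    (fun p q z h hz => hmem (star S) (star T) p q h z hz)
  refine ⟨R, fun x y => ?_⟩
  obtain ⟨α, hα⟩ := E.mem_domain_iff.1 x.2
  obtain ⟨β, hβ⟩ := G.mem_domain_iff.1 y.2
  rw [hR (α, β) ⟨htmul x y, htmul_mem_domain E G x.2 y.2⟩ (htmul_mem hα hβ), tensorL_htmul, E.cut_of_mem S x hα, G.cut_of_mem T y hβ]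

/-- Elements of `C*_{E × G}(D ⊗ F)` are determined by their values on elementary tensors. -/
lemma tensor_ext (E : QuantizedDomain Γ H) (G : QuantizedDomain Λ K)
    {R R' : (E.tensor G).starAlg}
    (h : ∀ (x : E.domain) (y : G.domain),
      ((R : Module.End ℂ (E.tensor G).domain) ⟨htmul x y, htmul_mem_domain E G x.2 y.2⟩ :
          HilbertTensor H K) =
        (R' : Module.End ℂ (E.tensor G).domain) ⟨htmul x y, htmul_mem_domain E G x.2 y.2⟩) :
    R = R' := by
  refine (E.tensor G).starAlg_ext fun p z hz => ?_
  rw [← (E.tensor G).cut_of_mem R z hz, ← (E.tensor G).cut_of_mem R' z hz]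
  refine eq_on_tensorSpace (fun x hx y hy => ?_) hz
  have hm : htmul x y ∈ (E.tensor G).space p := htmul_mem hx hy
  exact ((E.tensor G).cut_of_mem R ⟨_, (E.tensor G).mem_domain hm⟩ hm).trans
    ((h ⟨x, E.mem_domain hx⟩ ⟨y, G.mem_domain hy⟩).trans
      ((E.tensor G).cut_of_mem R' ⟨_, (E.tensor G).mem_domain hm⟩ hm).symm)

/-- For `S ∈ C*_E(D)` and `T ∈ C*_G(F)`, the operator `S ⊗ T ∈ C*_{E × G}(D ⊗ F)`.  It is the only
element of that algebra with `(S ⊗ T)(x ⊗ y) = S x ⊗ T y` for all `x ∈ D`, `y ∈ F`. -/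
noncomputable def tensorOp (E : QuantizedDomain Γ H) (G : QuantizedDomain Λ K)
    (S : E.starAlg) (T : G.starAlg) : (E.tensor G).starAlg :=
  (exists_tensorOp E G S T).choose

lemma tensorOp_htmul (E : QuantizedDomain Γ H) (G : QuantizedDomain Λ K)
    (S : E.starAlg) (T : G.starAlg) (x : E.domain) (y : G.domain) :
    ((tensorOp E G S T : Module.End ℂ (E.tensor G).domain)
        ⟨htmul x y, htmul_mem_domain E G x.2 y.2⟩ : HilbertTensor H K) =
      htmul ((S : Module.End ℂ E.domain) x : H) ((T : Module.End ℂ G.domain) y : K) :=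
  (exists_tensorOp E G S T).choose_spec x y

lemma htmul_add_left (x x' : H) (y : K) : htmul (x + x') y = htmul x y + htmul x' y := by
  simp only [htmul, TensorProduct.add_tmul, map_add]

lemma htmul_add_right (x : H) (y y' : K) : htmul x (y + y') = htmul x y + htmul x y' := by
  simp only [htmul, TensorProduct.tmul_add, map_add]

lemma htmul_smul_left (c : ℂ) (x : H) (y : K) : htmul (c • x) y = c • htmul x y := by
  simp only [htmul, TensorProduct.smul_tmul', ← map_smul]

lemma htmul_smul_right (c : ℂ) (x : H) (y : K) : htmul x (c • y) = c • htmul x y := by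
  simp only [htmul, TensorProduct.tmul_smul, ← map_smul]

/-- The linear map `C*_E(D) ⊗ C*_G(F) → C*_{E × G}(D ⊗ F)`, `S ⊗ T ↦ S ⊗ T`. -/
noncomputable def tensorHom (E : QuantizedDomain Γ H) (G : QuantizedDomain Λ K) :
    E.starAlg ⊗[ℂ] G.starAlg →ₗ[ℂ] (E.tensor G).starAlg :=
  TensorProduct.lift <| LinearMap.mk₂ ℂ (tensorOp E G)
    (fun S S' T => tensor_ext E G fun x y => by
      simp only [Subalgebra.coe_add, LinearMap.add_apply, Submodule.coe_add, tensorOp_htmul,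
        htmul_add_left])
    (fun c S T => tensor_ext E G fun x y => by
      simp only [Subalgebra.coe_smul, LinearMap.smul_apply, Submodule.coe_smul, tensorOp_htmul,
        htmul_smul_left])
    (fun S T T' => tensor_ext E G fun x y => by
      simp only [Subalgebra.coe_add, LinearMap.add_apply, Submodule.coe_add, tensorOp_htmul,
        htmul_add_right])
    (fun c S T => tensor_ext E G fun x y => by
      simp only [Subalgebra.coe_smul, LinearMap.smul_apply, Submodule.coe_smul, tensorOp_htmul,
        htmul_smul_right])

/-- The map `i ⊗ j : V ⊗ W → C*_{E × G}(D ⊗ F)`, for linear maps `i : V → C*_E(D)` and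
`j : W → C*_G(F)`. -/
noncomputable def tensorEmbedding {V W : Type*} [AddCommGroup V] [Module ℂ V]
    [AddCommGroup W] [Module ℂ W] (E : QuantizedDomain Γ H) (G : QuantizedDomain Λ K)
    (i : V →ₗ[ℂ] E.starAlg) (j : W →ₗ[ℂ] G.starAlg) : V ⊗[ℂ] W →ₗ[ℂ] (E.tensor G).starAlg :=
  tensorHom E G ∘ₗ TensorProduct.map i j

end Tensor

/-! ## Embeddings into `C*_E(D)` -/

section Embedding

variable {Γ V H : Type*} [AddCommGroup V] [Module ℂ V]
  [NormedAddCommGroup H] [InnerProductSpace ℂ H] [CompleteSpace H]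

/-- The spatial cones on `V` induced by a linear map `i : V → C*_E(D)`. -/
def inducedCone (E : QuantizedDomain Γ H) (i : V →ₗ[ℂ] E.starAlg) (α : Γ) (n : ℕ) :
    Set (Matrix (Fin n) (Fin n) V) :=
  {A | A.map i ∈ E.cone α n}

/-- `i : V → C*_E(D)` is a local unital complete order isomorphism onto its range: it is injective
and unital, and, for every `α` and `n`, `A ∈ C_α^n` if and only if `i⁽ⁿ⁾(A)` is in the local
positive cone of `M_n(C*_E(D))` at `α`. -/
structure IsLocalOrderEmbedding (C : Γ → ∀ n : ℕ, Set (Matrix (Fin n) (Fin n) V)) (e : V)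
    (E : QuantizedDomain Γ H) (i : V →ₗ[ℂ] E.starAlg) : Prop where
  injective : Function.Injective i
  map_unit : i e = 1
  cone_eq : ∀ α n, C α n = E.inducedCone i α n

end Embedding

end QuantizedDomain
end LocalOpSys

/-! Everything rests on one equality: the `lmin` cone at `(α, β)` is the spatial cone that `iV ⊗ iW`
induces from `H_α ⊗ K_β`. The axioms of a local operator system then hold because the cones induced
by any unital `*`-preserving injection into an algebra `C*_E(D)` satisfy them
(`isLocalOperatorSystem_inducedCone`).

Both kinds of positivity are statements about one expression, `pairingForm f g c A`, where `f` and
`g` are matrices of functionals on `V` and `W`. With matrix entries of LUCP maps it is the quadratic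
form of `(φ ⊗ ψ)⁽ⁿ⁾(A)`. With vector functionals `⟨ξ_a, i(·) ξ_a'⟩` it is the quadratic form of `(iV
⊗ iW)⁽ⁿ⁾(A)` at combinations of elementary tensors.

Spatial implies `lmin` (`inducedCone_subset_lminCone`): slicing `A` by the functionals of one factor
leaves a matrix over the other. Complete positivity of `φ` reduces the claim to membership of such a
slice in `C_α`, which `iV` turns into positivity against vector functionals. Repeating this with `ψ`
and `iW` replaces all entry functionals by vector functionals. No extension or dilation of `φ` and
`ψ` is needed.

`lmin` implies spatial (`lminCone_subset_inducedCone`): compressing `iV` and `iW` to finite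
orthonormal systems in `H_α` and `K_β` gives LUCP maps. These test positivity on algebraic tensors,
and continuity of the form extends it to the closure. -/

namespace LocalOpSys

/-! ### Linear maps and the involution. -/

section StarLinear

/-- A linear map that preserves the involution on hermitian elements preserves it everywhere. -/
lemma map_star_of_isSelfAdjoint {V M : Type*} [AddCommGroup V] [Module ℂ V] [StarAddMonoid V]
    [StarModule ℂ V] [AddCommMonoid M] [Module ℂ M] [StarAddMonoid M] [StarModule ℂ M]
    (f : V →ₗ[ℂ] M) (h : ∀ v, star v = v → star (f v) = f v) (v : V) :
    f (star v) = star (f v) := by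
  have hr := h _ (realPart v).2
  have hi := h _ (imaginaryPart v).2
  conv_lhs => rw [← realPart_add_I_smul_imaginaryPart v]
  conv_rhs => rw [← realPart_add_I_smul_imaginaryPart v]
  rw [star_add, star_smul, map_add, map_smul, map_add, map_smul, star_add, star_smul, hr, hi,
    show star (realPart v : V) = realPart v from (realPart v).2,
    show star (imaginaryPart v : V) = imaginaryPart v from (imaginaryPart v).2]

end StarLinear

/-! ### Product functionals, slice maps and slices of matrices over `V ⊗ W`. -/

section Pairing

variable {V W : Type*} [AddCommGroup V] [Module ℂ V] [AddCommGroup W] [Module ℂ W]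

/-- The functional `f ⊗ g` on `V ⊗ W`. -/
noncomputable def pairing (f : V →ₗ[ℂ] ℂ) (g : W →ₗ[ℂ] ℂ) : V ⊗[ℂ] W →ₗ[ℂ] ℂ :=
  LinearMap.mul' ℂ ℂ ∘ₗ TensorProduct.map f g

@[simp] lemma pairing_tmul (f : V →ₗ[ℂ] ℂ) (g : W →ₗ[ℂ] ℂ) (v : V) (w : W) :
    pairing f g (v ⊗ₜ w) = f v * g w := by
  simp [pairing]

/-- The slice map `id ⊗ g : V ⊗ W → V`. -/
noncomputable def sliceRight (V : Type*) [AddCommGroup V] [Module ℂ V] (g : W →ₗ[ℂ] ℂ) :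
    V ⊗[ℂ] W →ₗ[ℂ] V :=
  (TensorProduct.rid ℂ V).toLinearMap ∘ₗ g.lTensor V

@[simp] lemma sliceRight_tmul (g : W →ₗ[ℂ] ℂ) (v : V) (w : W) :
    sliceRight V g (v ⊗ₜ w) = g w • v := by
  simp [sliceRight]

/-- The slice map `f ⊗ id : V ⊗ W → W`. -/
noncomputable def sliceLeft (W : Type*) [AddCommGroup W] [Module ℂ W] (f : V →ₗ[ℂ] ℂ) :
    V ⊗[ℂ] W →ₗ[ℂ] W :=
  (TensorProduct.lid ℂ W).toLinearMap ∘ₗ f.rTensor W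

@[simp] lemma sliceLeft_tmul (f : V →ₗ[ℂ] ℂ) (v : V) (w : W) :
    sliceLeft W f (v ⊗ₜ w) = f v • w := by
  simp [sliceLeft]

lemma apply_sliceRight (f : V →ₗ[ℂ] ℂ) (g : W →ₗ[ℂ] ℂ) (u : V ⊗[ℂ] W) :
    f (sliceRight V g u) = pairing f g u := by
  induction u with
  | zero => simp
  | tmul v w => simp [mul_comm]
  | add a b ha hb => simp [ha, hb]

lemma apply_sliceLeft (f : V →ₗ[ℂ] ℂ) (g : W →ₗ[ℂ] ℂ) (u : V ⊗[ℂ] W) :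
    g (sliceLeft W f u) = pairing f g u := by
  induction u with
  | zero => simp
  | tmul v w => simp
  | add a b ha hb => simp [ha, hb]

/-- A basis of `W` identifies `V ⊗ W` with finitely supported families in `V`, and the members of
the family are the slices by the coordinate functionals. -/
lemma eq_zero_of_sliceRight {u : V ⊗[ℂ] W} (h : ∀ g : W →ₗ[ℂ] ℂ, sliceRight V g u = 0) :
    u = 0 := by
  classical
  let b := Module.Basis.ofVectorSpace ℂ W
  refine (TensorProduct.equivFinsuppOfBasisRight (M := V) b).injective ?_
  ext i
  rw [TensorProduct.equivFinsuppOfBasisRight_apply, map_zero]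
  exact h (b.coord i)

lemma tensorMatrixMap_apply {ι κ : Type*} (φ : V →ₗ[ℂ] Matrix ι ι ℂ) (ψ : W →ₗ[ℂ] Matrix κ κ ℂ)
    (u : V ⊗[ℂ] W) (s t : ι × κ) :
    tensorMatrixMap φ ψ u s t =
      pairing (Matrix.entryLinearMap ℂ ℂ s.1 t.1 ∘ₗ φ) (Matrix.entryLinearMap ℂ ℂ s.2 t.2 ∘ₗ ψ)
        u := by
  induction u with
  | zero => simp
  | tmul v w => rw [pairing_tmul]; rfl
  | add a b ha hb => simp [ha, hb]

variable {n ι κ : Type*} [Fintype n] [Fintype ι] [Fintype κ]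

/-- The value of the matrix of functionals `f ⊗ g` on `A`, compressed by the vector `c`. -/
noncomputable def pairingForm (f : ι → ι → V →ₗ[ℂ] ℂ) (g : κ → κ → W →ₗ[ℂ] ℂ) (c : n → ι → κ → ℂ)
    (A : Matrix n n (V ⊗[ℂ] W)) : ℂ :=
  ∑ i, ∑ j, ∑ a, ∑ b, ∑ a', ∑ b',
    star (c i a b) * c j a' b' * pairing (f a a') (g b b') (A i j)

/-- The matrix over `V` obtained from `A` by slicing with `g` and compressing by `c`. -/
noncomputable def matrixSliceRight (g : κ → κ → W →ₗ[ℂ] ℂ) (c : n → ι → κ → ℂ)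
    (A : Matrix n n (V ⊗[ℂ] W)) : Matrix ι ι V :=
  Matrix.of fun a a' => ∑ i, ∑ j, ∑ b, ∑ b',
    (star (c i a b) * c j a' b') • sliceRight V (g b b') (A i j)

/-- The matrix over `W` obtained from `A` by slicing with `f` and compressing by `c`. -/
noncomputable def matrixSliceLeft (f : ι → ι → V →ₗ[ℂ] ℂ) (c : n → ι → κ → ℂ)
    (A : Matrix n n (V ⊗[ℂ] W)) : Matrix κ κ W :=
  Matrix.of fun b b' => ∑ i, ∑ j, ∑ a, ∑ a',
    (star (c i a b) * c j a' b') • sliceLeft W (f a a') (A i j)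

/-- Together with `sum_apply_matrixSliceLeft` this evaluates the same form through either factor, so
the functionals on `V` and on `W` can be exchanged one factor at a time. -/
lemma sum_apply_matrixSliceRight (f : ι → ι → V →ₗ[ℂ] ℂ) (g : κ → κ → W →ₗ[ℂ] ℂ)
    (c : n → ι → κ → ℂ) (A : Matrix n n (V ⊗[ℂ] W)) :
    ∑ a, ∑ a', f a a' (matrixSliceRight g c A a a') = pairingForm f g c A := by
  simp only [matrixSliceRight, Matrix.of_apply, map_sum, map_smul, apply_sliceRight, smul_eq_mul,
    pairingForm]
  simp only [← Finset.sum_product']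
  -- The summation order `(a, a', i, j, b, b')` is permuted to `(i, j, a, b, a', b')`.
  refine Finset.sum_bij' (fun x _ => (x.2.2.1, x.2.2.2.1, x.1, x.2.2.2.2.1, x.2.1, x.2.2.2.2.2))
    (fun y _ => (y.2.2.1, y.2.2.2.2.1, y.1, y.2.1, y.2.2.2.1, y.2.2.2.2.2)) ?_ ?_ ?_ ?_ ?_ <;>
  simp

lemma sum_apply_matrixSliceLeft (f : ι → ι → V →ₗ[ℂ] ℂ) (g : κ → κ → W →ₗ[ℂ] ℂ)
    (c : n → ι → κ → ℂ) (A : Matrix n n (V ⊗[ℂ] W)) :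
    ∑ b, ∑ b', g b b' (matrixSliceLeft f c A b b') = pairingForm f g c A := by
  simp only [matrixSliceLeft, Matrix.of_apply, map_sum, map_smul, apply_sliceLeft, smul_eq_mul,
    pairingForm]
  simp only [← Finset.sum_product']
  refine Finset.sum_bij' (fun x _ => (x.2.2.1, x.2.2.2.1, x.2.2.2.2.1, x.1, x.2.2.2.2.2, x.2.1))
    (fun y _ => (y.2.2.2.1, y.2.2.2.2.2, y.1, y.2.1, y.2.2.1, y.2.2.2.2.1)) ?_ ?_ ?_ ?_ ?_ <;>
  simp

variable [StarAddMonoid V] [StarModule ℂ V] [StarAddMonoid W] [StarModule ℂ W]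

lemma star_sliceRight {g g' : W →ₗ[ℂ] ℂ} (h : ∀ w, g' (star w) = star (g w)) (u : V ⊗[ℂ] W) :
    star (sliceRight V g u) = sliceRight V g' (star u) := by
  induction u with
  | zero => simp
  | tmul v w => simp [h]
  | add a b ha hb => simp [ha, hb]

lemma star_sliceLeft {f f' : V →ₗ[ℂ] ℂ} (h : ∀ v, f' (star v) = star (f v)) (u : V ⊗[ℂ] W) :
    star (sliceLeft W f u) = sliceLeft W f' (star u) := by
  induction u with
  | zero => simp
  | tmul v w => simp [h]
  | add a b ha hb => simp [ha, hb]

/-- The involution exchanges `i` with `j` and `b` with `b'`; `hg` says that the matrix of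
functionals is itself hermitian, so the double sums are preserved. -/
lemma isHermitian_matrixSliceRight {g : κ → κ → W →ₗ[ℂ] ℂ}
    (hg : ∀ b b' w, g b b' (star w) = star (g b' b w)) (c : n → ι → κ → ℂ)
    {A : Matrix n n (V ⊗[ℂ] W)} (hA : A.IsHermitian) : (matrixSliceRight g c A).IsHermitian := by
  ext a a'
  simp only [matrixSliceRight, Matrix.conjTranspose_apply, Matrix.of_apply, star_sum, star_smul,
    star_sliceRight (hg _ _), hA.apply]
  rw [Finset.sum_comm]
  refine Finset.sum_congr rfl fun i _ => Finset.sum_congr rfl fun j _ => ?_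
  rw [Finset.sum_comm]
  refine Finset.sum_congr rfl fun b _ => Finset.sum_congr rfl fun b' _ => ?_
  rw [star_mul', star_star, mul_comm]

lemma isHermitian_matrixSliceLeft {f : ι → ι → V →ₗ[ℂ] ℂ}
    (hf : ∀ a a' v, f a a' (star v) = star (f a' a v)) (c : n → ι → κ → ℂ)
    {A : Matrix n n (V ⊗[ℂ] W)} (hA : A.IsHermitian) : (matrixSliceLeft f c A).IsHermitian := by
  ext b b'
  simp only [matrixSliceLeft, Matrix.conjTranspose_apply, Matrix.of_apply, star_sum, star_smul,
    star_sliceLeft (hf _ _), hA.apply]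
  rw [Finset.sum_comm]
  refine Finset.sum_congr rfl fun i _ => Finset.sum_congr rfl fun j _ => ?_
  rw [Finset.sum_comm]
  refine Finset.sum_congr rfl fun a _ => Finset.sum_congr rfl fun a' _ => ?_
  rw [star_mul', star_star, mul_comm]

end Pairing

/-! ### Consequences of complete positivity. -/

section LUCP

variable {Γ V W : Type*}
  [AddCommGroup V] [Module ℂ V] [StarAddMonoid V] [StarModule ℂ V]
  [AddCommGroup W] [Module ℂ W] [StarAddMonoid W] [StarModule ℂ W]

/-- The block matrix `φ⁽ᵏ⁾(Q)` is tested on the vector `∑ e_a ⊗ e_a`, as in Choi's correspondence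
between maps and functionals. -/
lemma IsLUCP.sum_nonneg {k : ℕ} {P : ∀ n : ℕ, Set (Matrix (Fin n) (Fin n) V)} {e : V}
    {φ : V →ₗ[ℂ] Matrix (Fin k) (Fin k) ℂ} (hφ : IsLUCP P e φ) {Q : Matrix (Fin k) (Fin k) V}
    (hQ : Q ∈ P k) : 0 ≤ ∑ a, ∑ a', φ (Q a a') a a' := by
  have h := (hφ.posSemidef k Q hQ).dotProduct_mulVec_nonneg fun s => if s.1 = s.2 then 1 else 0
  simpa [dotProduct, Matrix.mulVec, Fintype.sum_prod_type] using h

/-- For hermitian `v` the order unit puts some `r e - v` in the cone. Its image is positive, hence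
hermitian, and `φ e = 1` transfers this to `φ v`. -/
lemma IsLUCP.map_star {C : Γ → ∀ n : ℕ, Set (Matrix (Fin n) (Fin n) V)} {e : V}
    (hC : IsLocalOperatorSystem C e) {α : Γ} {ι : Type*} [Fintype ι] [DecidableEq ι]
    {φ : V →ₗ[ℂ] Matrix ι ι ℂ} (hφ : IsLUCP (C α) e φ) (v : V) : φ (star v) = star (φ v) := by
  refine map_star_of_isSelfAdjoint φ (fun v hv => ?_) v
  obtain ⟨r, -, hr⟩ := hC.order_unit α 1 (Matrix.of fun _ _ => v) (by ext; simpa using hv)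
  have h := (hφ.posSemidef 1 _ hr).isHermitian
  have h0 : star (φ ((r : ℂ) • e - v)) = φ ((r : ℂ) • e - v) := by
    ext a b
    have hab := h.apply (0, a) (0, b)
    simp only [Matrix.comp_apply, Matrix.map_apply, Matrix.sub_apply, Matrix.smul_apply,
      Matrix.diagonal_apply_eq, Matrix.of_apply] at hab
    exact hab
  have h1 : φ v = (r : ℂ) • (1 : Matrix ι ι ℂ) - φ ((r : ℂ) • e - v) := by
    rw [map_sub, map_smul, hφ.map_unit, sub_sub_cancel]
  rw [h1, star_sub, h0, star_smul, star_one, Complex.star_def, Complex.conj_ofReal]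

end LUCP

end LocalOpSys

namespace LocalOpSys

namespace QuantizedDomain

/-! ### The involution and the quadratic forms of `C*_E(D)`. -/

section StarAlgebra

variable {Γ H : Type*} [NormedAddCommGroup H] [InnerProductSpace ℂ H] [CompleteSpace H]

/-- The involution is obtained by choice; nondegeneracy of the inner product on `D` makes the
adjoint unique, and the laws of the involution are checked through this. -/
lemma star_eq_of_inner (E : QuantizedDomain Γ H) {S T : E.starAlg}
    (h : ∀ x y : E.domain, ⟪((T : Module.End ℂ E.domain) x : H), y⟫_ℂ =
      ⟪(x : H), (S : Module.End ℂ E.domain) y⟫_ℂ) : star T = S := by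
  refine Subtype.ext (LinearMap.ext fun y => ext_inner_left ℂ fun x => ?_)
  exact (E.inner_star T x y).symm.trans (h x y)

lemma inner_star_left (E : QuantizedDomain Γ H) (T : E.starAlg) (x y : E.domain) :
    ⟪((star T : E.starAlg) : Module.End ℂ E.domain) x, y⟫_ℂ =
      ⟪x, (T : Module.End ℂ E.domain) y⟫_ℂ := by
  rw [← inner_conj_symm, ← inner_conj_symm x]
  exact congrArg (starRingEnd ℂ) (E.inner_star T y x).symm

noncomputable instance instStarAddMonoid (E : QuantizedDomain Γ H) : StarAddMonoid E.starAlg where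
  star_involutive T := E.star_eq_of_inner fun x y => E.inner_star_left T x y
  star_add S T := E.star_eq_of_inner fun x y => by
    simp only [Subalgebra.coe_add, LinearMap.add_apply, Submodule.coe_add, inner_add_left,
      inner_add_right, E.inner_star]

instance instStarModule (E : QuantizedDomain Γ H) : StarModule ℂ E.starAlg where
  star_smul c T := E.star_eq_of_inner fun x y => by
    simp only [Subalgebra.coe_smul, LinearMap.smul_apply, Submodule.coe_smul, inner_smul_left,
      inner_smul_right, E.inner_star, RCLike.star_def]

lemma starAlg_star_one (E : QuantizedDomain Γ H) : star (1 : E.starAlg) = 1 :=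
  E.star_eq_of_inner fun _ _ => rfl

/-- The functional `T ↦ ⟨x, T y⟩` on `C*_E(D)`. -/
noncomputable def vectorFunctional (E : QuantizedDomain Γ H) (x y : E.domain) :
    E.starAlg →ₗ[ℂ] ℂ where
  toFun T := ⟪x, (T : Module.End ℂ E.domain) y⟫_ℂ
  map_add' _ _ := inner_add_right _ _ _
  map_smul' _ _ := inner_smul_right _ _ _

lemma vectorFunctional_apply (E : QuantizedDomain Γ H) (x y : E.domain) (T : E.starAlg) :
    E.vectorFunctional x y T = ⟪x, (T : Module.End ℂ E.domain) y⟫_ℂ := rfl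

lemma vectorFunctional_star (E : QuantizedDomain Γ H) (x y : E.domain) (T : E.starAlg) :
    E.vectorFunctional x y (star T) = star (E.vectorFunctional y x T) := by
  simp only [vectorFunctional_apply]
  rw [← inner_conj_symm, E.inner_star_left]
  rfl

lemma eq_zero_of_vectorFunctional (E : QuantizedDomain Γ H) {T : E.starAlg}
    (h : ∀ x y, E.vectorFunctional x y T = 0) : T = 0 :=
  Subtype.ext <| LinearMap.ext fun y => ext_inner_left ℂ fun x =>
    (h x y).trans (inner_zero_right x).symm

/-- The quadratic form `⟨ξ, A ξ⟩` of a matrix `A` over `C*_E(D)`. -/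
noncomputable def quadForm (E : QuantizedDomain Γ H) {n : Type*} [Fintype n]
    (A : Matrix n n E.starAlg) (ξ : n → E.domain) : ℂ :=
  ∑ i, ∑ j, E.vectorFunctional (ξ i) (ξ j) (A i j)

lemma mem_cone_iff (E : QuantizedDomain Γ H) {α : Γ} {n : ℕ}
    {A : Matrix (Fin n) (Fin n) E.starAlg} :
    A ∈ E.cone α n ↔ A.IsHermitian ∧
      ∀ ξ : Fin n → E.domain, (∀ i, (ξ i : H) ∈ E.space α) → 0 ≤ E.quadForm A ξ := Iff.rfl

lemma quadForm_add (E : QuantizedDomain Γ H) {n : Type*} [Fintype n] (A B : Matrix n n E.starAlg)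
    (ξ : n → E.domain) : E.quadForm (A + B) ξ = E.quadForm A ξ + E.quadForm B ξ := by
  simp only [quadForm, Matrix.add_apply, map_add, Finset.sum_add_distrib]

lemma quadForm_smul (E : QuantizedDomain Γ H) {n : Type*} [Fintype n] (c : ℂ)
    (A : Matrix n n E.starAlg) (ξ : n → E.domain) :
    E.quadForm (c • A) ξ = c * E.quadForm A ξ := by
  simp only [quadForm, Matrix.smul_apply, map_smul, Finset.mul_sum, smul_eq_mul]

lemma quadForm_one (E : QuantizedDomain Γ H) {n : Type*} [Fintype n] [DecidableEq n]
    (ξ : n → E.domain) : E.quadForm 1 ξ = ((∑ i, ‖ξ i‖ ^ 2 : ℝ) : ℂ) := by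
  have h : ∀ i j, E.vectorFunctional (ξ i) (ξ j) ((1 : Matrix n n E.starAlg) i j) =
      if i = j then ((‖ξ i‖ ^ 2 : ℝ) : ℂ) else 0 := by
    intro i j
    split_ifs with hij
    · subst hij
      rw [Matrix.one_apply_eq, vectorFunctional_apply]
      simp
    · rw [Matrix.one_apply_ne hij, map_zero]
  simp only [quadForm, h, Finset.sum_ite_eq, Finset.mem_univ, if_true]
  push_cast
  rfl

/-- The order on `ℂ` demands a vanishing imaginary part, so positivity of a form needs this besides
an estimate of its real part. -/
lemma quadForm_im (E : QuantizedDomain Γ H) {n : Type*} [Fintype n] {A : Matrix n n E.starAlg}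
    (hA : A.IsHermitian) (ξ : n → E.domain) : (E.quadForm A ξ).im = 0 := by
  rw [← Complex.conj_eq_iff_im]
  simp only [quadForm, map_sum]
  rw [Finset.sum_comm]
  refine Finset.sum_congr rfl fun i _ => Finset.sum_congr rfl fun j _ => ?_
  rw [starRingEnd_apply, ← vectorFunctional_star, hA.apply]

/-- This provides the order unit: `r` dominates the form on `H_α` because every entry of `A` is
bounded there. -/
lemma exists_quadForm_le (E : QuantizedDomain Γ H) {n : Type*} [Fintype n] (α : Γ)
    (A : Matrix n n E.starAlg) :
    ∃ r : ℝ, 0 < r ∧ ∀ ξ : n → E.domain, (∀ i, (ξ i : H) ∈ E.space α) →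
      ‖E.quadForm A ξ‖ ≤ r * ∑ i, ‖ξ i‖ ^ 2 := by
  choose c hc using fun i j => E.starAlg_bound (A i j) α
  -- The summand `1` only makes the constant strictly positive.
  refine ⟨∑ i, ∑ j, |c i j| + 1, by positivity, fun ξ hξ => ?_⟩
  have hle : ∀ i, ‖ξ i‖ ^ 2 ≤ ∑ k, ‖ξ k‖ ^ 2 := fun i =>
    Finset.single_le_sum (f := fun k => ‖ξ k‖ ^ 2) (fun _ _ => by positivity) (Finset.mem_univ i)
  have h0 : 0 ≤ ∑ k, ‖ξ k‖ ^ 2 := by positivity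
  calc ‖E.quadForm A ξ‖ ≤ ∑ i, ∑ j, |c i j| * ∑ k, ‖ξ k‖ ^ 2 := by
        refine norm_sum_le_of_le _ fun i _ => norm_sum_le_of_le _ fun j _ => ?_
        calc ‖E.vectorFunctional (ξ i) (ξ j) (A i j)‖
            ≤ ‖ξ i‖ * ‖(A i j : Module.End ℂ E.domain) (ξ j)‖ := norm_inner_le_norm _ _
          _ ≤ ‖ξ i‖ * (|c i j| * ‖ξ j‖) := by
            gcongr
            exact (hc i j _ (hξ j)).trans (by gcongr; exact le_abs_self _)
          _ = |c i j| * (‖ξ i‖ * ‖ξ j‖) := by ring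
          _ ≤ |c i j| * ∑ k, ‖ξ k‖ ^ 2 := by
            gcongr
            nlinarith [hle i, hle j, sq_nonneg (‖ξ i‖ - ‖ξ j‖)]
    _ = (∑ i, ∑ j, |c i j|) * ∑ k, ‖ξ k‖ ^ 2 := by simp only [Finset.sum_mul]
    _ ≤ (∑ i, ∑ j, |c i j| + 1) * ∑ k, ‖ξ k‖ ^ 2 := by gcongr; linarith

/-- Compression of the quadratic form by a scalar matrix. -/
lemma quadForm_conjBy (E : QuantizedDomain Γ H) {n m : ℕ} (X : Matrix (Fin n) (Fin m) ℂ)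
    (A : Matrix (Fin n) (Fin n) E.starAlg) (ξ : Fin m → E.domain) :
    E.quadForm (conjBy X A) ξ = E.quadForm A fun k => ∑ i, X k i • ξ i := by
  simp only [quadForm, conjBy, Matrix.of_apply, map_sum, map_smul, vectorFunctional_apply,
    sum_inner, inner_sum, inner_smul_left, inner_smul_right, smul_eq_mul, Finset.mul_sum]
  simp only [← Finset.sum_product']
  refine Finset.sum_bij' (fun x _ => (x.2.2.1, x.2.2.2, x.2.1, x.1))
    (fun y _ => (y.2.2.2, y.2.2.1, y.1, y.2.1)) ?_ ?_ ?_ ?_ ?_ <;>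
  simp [mul_assoc, mul_left_comm]

/-- A matrix with vanishing quadratic form is zero. -/
lemma eq_zero_of_quadForm (E : QuantizedDomain Γ H) {n : Type*} [Fintype n] [DecidableEq n]
    {A : Matrix n n E.starAlg} (h : ∀ ξ, E.quadForm A ξ = 0) : A = 0 := by
  -- Polarization: the values at `ξ + η` and `ξ + I • η` isolate the sesquilinear form.
  have key : ∀ ξ η : n → E.domain,
      ∑ i, ∑ j, E.vectorFunctional (ξ i) (η j) (A i j) = 0 := by
    intro ξ η
    have h1 := h (ξ + η)
    have h2 := h (ξ + Complex.I • η)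
    have h3 := h ξ
    have h4 := h η
    simp only [quadForm, vectorFunctional_apply, Pi.add_apply, Pi.smul_apply, map_add, map_smul,
      inner_add_left, inner_add_right, inner_smul_left, inner_smul_right, Finset.sum_add_distrib,
      ← Finset.mul_sum, Complex.conj_I] at h1 h2 h3 h4 ⊢
    rw [h3, h4] at h1 h2
    linear_combination (1 / 2) * h1 - (Complex.I / 2) * h2 +
      (1 / 2) * (∑ i, ∑ j, ⟪ξ i, (A i j : Module.End ℂ E.domain) (η j)⟫_ℂ -
        ∑ i, ∑ j, ⟪η i, (A i j : Module.End ℂ E.domain) (ξ j)⟫_ℂ) * Complex.I_sq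
  ext1 i j
  refine E.eq_zero_of_vectorFunctional fun x y => ?_
  have := key (Pi.single i x) (Pi.single j y)
  rw [Finset.sum_eq_single i, Finset.sum_eq_single j] at this
  · simpa using this
  · intro b _ hb
    simp [vectorFunctional_apply, Pi.single_eq_of_ne hb]
  · simp
  · intro b _ hb
    simp [vectorFunctional_apply, Pi.single_eq_of_ne hb]
  · simp

end StarAlgebra

/-! ### Cones induced by an embedding into `C*_E(D)`. -/

section Induced

variable {Γ V H : Type*} [AddCommGroup V] [Module ℂ V] [StarAddMonoid V] [StarModule ℂ V]
  [NormedAddCommGroup H] [InnerProductSpace ℂ H] [CompleteSpace H]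

/-- Preservation of the involution is not part of an order embedding. It follows from the order
unit, since members of the spatial cones are hermitian and `i e = 1`. -/
lemma map_star_of_isLocalOrderEmbedding {C : Γ → ∀ n : ℕ, Set (Matrix (Fin n) (Fin n) V)} {e : V}
    (hC : IsLocalOperatorSystem C e) {E : QuantizedDomain Γ H} {i : V →ₗ[ℂ] E.starAlg}
    (hi : E.IsLocalOrderEmbedding C e i) (v : V) : i (star v) = star (i v) := by
  refine map_star_of_isSelfAdjoint i (fun v hv => ?_) v
  obtain ⟨α⟩ := hC.nonempty
  obtain ⟨r, -, hr⟩ := hC.order_unit α 1 (Matrix.of fun _ _ => v) (by ext; simpa using hv)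
  rw [hi.cone_eq] at hr
  have h0 : star (i ((r : ℂ) • e - v)) = i ((r : ℂ) • e - v) := hr.1.apply 0 0
  have h1 : star (i ((r : ℂ) • e - v)) + star (i v) = i ((r : ℂ) • e - v) + i v := by
    rw [← star_add, ← map_add, sub_add_cancel, map_smul, hi.map_unit, star_smul, starAlg_star_one,
      Complex.star_def, Complex.conj_ofReal]
  rw [h0] at h1
  exact add_left_cancel h1

lemma isHermitian_map_iff {E : QuantizedDomain Γ H} {i : V →ₗ[ℂ] E.starAlg}
    (hinj : Function.Injective i) (hstar : ∀ v, i (star v) = star (i v)) {n : Type*}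
    {A : Matrix n n V} : (A.map i).IsHermitian ↔ A.IsHermitian := by
  constructor
  · intro h
    ext a b
    refine hinj ?_
    rw [Matrix.conjTranspose_apply, hstar]
    exact h.apply a b
  · intro h
    ext a b
    rw [Matrix.conjTranspose_apply, Matrix.map_apply, ← hstar, h.apply]
    rfl

lemma map_diagonal_unit {E : QuantizedDomain Γ H} {i : V →ₗ[ℂ] E.starAlg} {e : V}
    (he : i e = 1) {n : Type*} [DecidableEq n] :
    (Matrix.diagonal fun _ : n => e).map i = 1 := by
  rw [Matrix.diagonal_map (map_zero i)]
  simp only [he]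
  exact Matrix.diagonal_one

lemma map_conjBy {E : QuantizedDomain Γ H} (i : V →ₗ[ℂ] E.starAlg) {n m : ℕ}
    (X : Matrix (Fin n) (Fin m) ℂ) (A : Matrix (Fin n) (Fin n) V) :
    (conjBy X A).map i = conjBy X (A.map i) := by
  ext1 a b
  simp only [conjBy, Matrix.map_apply, Matrix.of_apply, map_sum, map_smul]

lemma isHermitian_conjBy {M : Type*} [AddCommGroup M] [Module ℂ M] [StarAddMonoid M]
    [StarModule ℂ M] {n m : ℕ} (X : Matrix (Fin n) (Fin m) ℂ) {A : Matrix (Fin n) (Fin n) M}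
    (hA : A.IsHermitian) : (conjBy X A).IsHermitian := by
  ext a b
  simp only [conjBy, Matrix.conjTranspose_apply, Matrix.of_apply, star_sum, star_smul, hA.apply]
  rw [Finset.sum_comm]
  refine Finset.sum_congr rfl fun i _ => Finset.sum_congr rfl fun j _ => ?_
  rw [star_mul', star_star, mul_comm]

/-- The cones induced by a `*`-preserving unital injection into `C*_E(D)` form a local operator
system. -/
theorem isLocalOperatorSystem_inducedCone (E : QuantizedDomain Γ H) (i : V →ₗ[ℂ] E.starAlg)
    (hinj : Function.Injective i) (hstar : ∀ v, i (star v) = star (i v)) {e : V} (he : i e = 1) :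
    IsLocalOperatorSystem (E.inducedCone i) e where
  nonempty := E.nonempty_index
  isHermitian α n A hA := (isHermitian_map_iff hinj hstar).1 hA.1
  zero_mem α n := by
    refine E.mem_cone_iff.2 ⟨?_, fun ξ _ => ?_⟩
    · rw [isHermitian_map_iff hinj hstar]
      exact Matrix.isHermitian_zero
    · simp [quadForm]
  add_mem α n A hA B hB := by
    refine E.mem_cone_iff.2 ⟨?_, fun ξ hξ => ?_⟩ <;> rw [Matrix.map_add _ (map_add i)]
    · exact hA.1.add hB.1
    · rw [quadForm_add]
      exact add_nonneg (hA.2 ξ hξ) (hB.2 ξ hξ)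
  smul_mem α n r hr A hA := by
    refine E.mem_cone_iff.2 ⟨?_, fun ξ hξ => ?_⟩ <;> rw [Matrix.map_smul _ _ fun v => map_smul i _ v]
    · ext1 a b
      rw [Matrix.conjTranspose_apply, Matrix.smul_apply, star_smul, Complex.star_def,
        Complex.conj_ofReal, hA.1.apply]
      rfl
    · rw [quadForm_smul]
      exact mul_nonneg (by exact_mod_cast hr) (hA.2 ξ hξ)
  directed α β := by
    obtain ⟨γ, h1, h2⟩ := E.directed α β
    exact ⟨γ, fun n A hA => ⟨⟨hA.1, fun ξ hξ => hA.2 ξ fun k => h1 (hξ k)⟩,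
      ⟨hA.1, fun ξ hξ => hA.2 ξ fun k => h2 (hξ k)⟩⟩⟩
  eq_zero n A hA := by
    have h0 : A.map i = 0 := by
      refine E.eq_zero_of_quadForm fun ξ => ?_
      -- The finitely many components of `ξ` lie in a common `H_γ`, since the family is directed;
      -- there both signs of the form are nonnegative.
      have hmem : ∃ γ, ∀ k, (ξ k : H) ∈ E.space γ := by
        choose idx hidx using fun k => E.mem_domain_iff.1 (ξ k).2
        have := E.nonempty_index
        obtain ⟨γ, hγ⟩ := E.directed.finite_le idx
        exact ⟨γ, fun k => hγ k (hidx k)⟩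
      obtain ⟨γ, hγ⟩ := hmem
      have h1 := (E.mem_cone_iff.1 (hA γ).1).2 ξ hγ
      have h2 := (E.mem_cone_iff.1 (hA γ).2).2 ξ hγ
      have h3 : (-A).map i = (-1 : ℂ) • A.map i := by
        rw [← neg_one_smul ℂ A, Matrix.map_smul _ _ fun v => map_smul i _ v]
      rw [h3, quadForm_smul, neg_one_mul, Left.nonneg_neg_iff] at h2
      exact le_antisymm h2 h1
    ext a b
    refine hinj ?_
    rw [Matrix.zero_apply, map_zero]
    exact congrFun₂ h0 a b
  conj_mem α n m X A hA := by
    refine E.mem_cone_iff.2 ⟨?_, fun ξ hξ => ?_⟩ <;> rw [map_conjBy]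
    · exact isHermitian_conjBy X hA.1
    · rw [quadForm_conjBy]
      refine hA.2 _ fun k => ?_
      rw [Submodule.coe_sum]
      exact Submodule.sum_mem _ fun j _ => Submodule.smul_mem _ _ (hξ j)
  star_unit := hinj (by rw [hstar, he, starAlg_star_one])
  order_unit α n A hA := by
    obtain ⟨r, hr, hle⟩ := E.exists_quadForm_le α (A.map i)
    have hA' := (isHermitian_map_iff hinj hstar).2 hA
    have hmap : ((r : ℂ) • Matrix.diagonal (fun _ => e) - A).map i =
        (r : ℂ) • (1 : Matrix (Fin n) (Fin n) E.starAlg) + (-1 : ℂ) • A.map i := by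
      rw [sub_eq_add_neg, ← neg_one_smul ℂ A, Matrix.map_add _ (map_add i),
        Matrix.map_smul _ _ fun v => map_smul i _ v, Matrix.map_smul _ _ fun v => map_smul i _ v,
        map_diagonal_unit he]
    have hone : (1 : Matrix (Fin n) (Fin n) E.starAlg).IsHermitian := by
      rw [← Matrix.diagonal_one, Matrix.IsHermitian, Matrix.diagonal_conjTranspose]
      congr 1
      exact funext fun _ => E.starAlg_star_one
    refine ⟨r, hr, E.mem_cone_iff.2 ⟨?_, fun ξ hξ => ?_⟩⟩ <;> rw [hmap]
    · ext1 a b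
      simp only [Matrix.conjTranspose_apply, Matrix.add_apply, Matrix.smul_apply, star_add,
        star_smul, hone.apply, hA'.apply]
      simp
    · have h1 := hle ξ hξ
      have him := E.quadForm_im hA' ξ
      rw [quadForm_add, quadForm_smul, quadForm_smul, quadForm_one, Complex.nonneg_iff]
      have hre := (Complex.re_le_norm (E.quadForm (A.map i) ξ)).trans h1
      simp only [Complex.add_re, Complex.add_im, Complex.re_ofReal_mul, Complex.im_ofReal_mul,
        Complex.ofReal_re, Complex.ofReal_im, neg_one_mul, Complex.neg_re, Complex.neg_im, him]
      constructor
      · linarith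
      · simp
  archimedean α n A hA := by
    have hmap : ∀ r : ℝ, ((r : ℂ) • Matrix.diagonal (fun _ => e) + A).map i =
        (r : ℂ) • (1 : Matrix (Fin n) (Fin n) E.starAlg) + A.map i := by
      intro r
      rw [← map_diagonal_unit he]
      ext1 a b
      simp only [Matrix.map_apply, Matrix.add_apply, Matrix.smul_apply, map_add, map_smul]
    refine E.mem_cone_iff.2 ⟨?_, fun ξ hξ => ?_⟩
    · have h1 := (hA 1 one_pos).1
      rw [isHermitian_map_iff hinj hstar] at h1 ⊢
      have h2 : (Matrix.diagonal fun _ : Fin n => e).IsHermitian := by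
        rw [Matrix.IsHermitian, Matrix.diagonal_conjTranspose]
        congr 1
        exact funext fun _ => hinj (by rw [Pi.star_apply, hstar, he, starAlg_star_one])
      rw [Complex.ofReal_one, one_smul] at h1
      simpa using h1.sub h2
    · have h1 : ∀ r : ℝ, 0 < r → 0 ≤ (r : ℂ) * ((∑ k, ‖ξ k‖ ^ 2 : ℝ) : ℂ) +
          E.quadForm (A.map i) ξ := by
        intro r hr
        have := (E.mem_cone_iff.1 (hA r hr)).2 ξ hξ
        rwa [hmap, quadForm_add, quadForm_smul, quadForm_one] at this
      -- The inequality for every `r > 0` passes to the limit as `r` decreases to `0`.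
      have hlim : Filter.Tendsto (fun r : ℝ => (r : ℂ) * ((∑ k, ‖ξ k‖ ^ 2 : ℝ) : ℂ) +
          E.quadForm (A.map i) ξ) (nhdsWithin 0 (Set.Ioi 0))
          (nhds (((0 : ℝ) : ℂ) * ((∑ k, ‖ξ k‖ ^ 2 : ℝ) : ℂ) + E.quadForm (A.map i) ξ)) := by
        refine Filter.Tendsto.mono_left (Continuous.tendsto ?_ 0) nhdsWithin_le_nhds
        fun_prop
      have := ge_of_tendsto hlim (Filter.mem_of_superset self_mem_nhdsWithin h1)
      simpa using this

end Induced

end QuantizedDomain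

end LocalOpSys

namespace LocalOpSys

/-! ### The quadratic form of `(φ ⊗ ψ)⁽ⁿ⁾(A)`. -/

section Forms

variable {V W : Type*} [AddCommGroup V] [Module ℂ V] [AddCommGroup W] [Module ℂ W]

/-- The test vector becomes the coefficient array `c`. This is the counterpart for matrix-valued
maps of `quadForm_tensorEmbedding`. -/
lemma dotProduct_comp_tensorMatrixMap {n ι κ : Type*} [Fintype n] [Fintype ι] [Fintype κ]
    (φ : V →ₗ[ℂ] Matrix ι ι ℂ) (ψ : W →ₗ[ℂ] Matrix κ κ ℂ) (A : Matrix n n (V ⊗[ℂ] W))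
    (x : n × ι × κ → ℂ) :
    star x ⬝ᵥ (Matrix.comp _ _ _ _ _ (A.map (tensorMatrixMap φ ψ))).mulVec x =
      pairingForm (fun a a' => Matrix.entryLinearMap ℂ ℂ a a' ∘ₗ φ)
        (fun b b' => Matrix.entryLinearMap ℂ ℂ b b' ∘ₗ ψ) (fun i a b => x (i, a, b)) A := by
  simp only [dotProduct, Matrix.mulVec, Matrix.comp_apply, Matrix.map_apply,
    tensorMatrixMap_apply, pairingForm, Fintype.sum_prod_type, Finset.mul_sum, Pi.star_apply]
  simp only [← Finset.sum_product']
  refine Finset.sum_bij' (fun x _ => (x.1, x.2.2.2.1, x.2.1, x.2.2.1, x.2.2.2.2.1, x.2.2.2.2.2))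
    (fun y _ => (y.1, y.2.2.1, y.2.2.2.1, y.2.1, y.2.2.2.2.1, y.2.2.2.2.2)) ?_ ?_ ?_ ?_ ?_ <;>
  simp [mul_assoc, mul_left_comm, mul_comm]

variable [StarAddMonoid V] [StarModule ℂ V] [StarAddMonoid W] [StarModule ℂ W]

lemma pairing_star {f f' : V →ₗ[ℂ] ℂ} {g g' : W →ₗ[ℂ] ℂ} (hf : ∀ v, f (star v) = star (f' v))
    (hg : ∀ w, g (star w) = star (g' w)) (u : V ⊗[ℂ] W) :
    pairing f g (star u) = star (pairing f' g' u) := by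
  induction u with
  | zero => simp
  | tmul v w => simp [hf, hg]
  | add a b ha hb => simp [ha, hb]

lemma tensorMatrixMap_star {ι κ : Type*} {φ : V →ₗ[ℂ] Matrix ι ι ℂ} {ψ : W →ₗ[ℂ] Matrix κ κ ℂ}
    (hφ : ∀ v, φ (star v) = star (φ v)) (hψ : ∀ w, ψ (star w) = star (ψ w)) (u : V ⊗[ℂ] W) :
    tensorMatrixMap φ ψ (star u) = star (tensorMatrixMap φ ψ u) := by
  ext s t
  rw [Matrix.star_apply, tensorMatrixMap_apply, tensorMatrixMap_apply]
  exact pairing_star (fun v => congrFun₂ (hφ v) _ _) (fun w => congrFun₂ (hψ w) _ _) u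

end Forms

namespace QuantizedDomain

/-! ### The embedding `iV ⊗ iW`: injectivity, unit, involution, quadratic form. -/

section TensorEmbedding

variable {Γ Λ V W H K : Type*}
  [AddCommGroup V] [Module ℂ V] [AddCommGroup W] [Module ℂ W]
  [NormedAddCommGroup H] [InnerProductSpace ℂ H] [CompleteSpace H]
  [NormedAddCommGroup K] [InnerProductSpace ℂ K] [CompleteSpace K]

/-- The elementary tensor `x ⊗ y` as an element of the union space `D ⊗ F`. -/
noncomputable def domainTmul (E : QuantizedDomain Γ H) (G : QuantizedDomain Λ K) (x : E.domain)
    (y : G.domain) : (E.tensor G).domain :=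
  ⟨htmul x y, htmul_mem_domain E G x.2 y.2⟩

variable (E : QuantizedDomain Γ H) (G : QuantizedDomain Λ K)
  (iV : V →ₗ[ℂ] E.starAlg) (iW : W →ₗ[ℂ] G.starAlg)

lemma tensorEmbedding_tmul (v : V) (w : W) :
    E.tensorEmbedding G iV iW (v ⊗ₜ w) = tensorOp E G (iV v) (iW w) := rfl

/-- Inner products of elementary tensors factor, so vector functionals at elementary tensors are
product functionals. -/
lemma vectorFunctional_tensorEmbedding (x x' : E.domain) (y y' : G.domain) (u : V ⊗[ℂ] W) :
    (E.tensor G).vectorFunctional (E.domainTmul G x y) (E.domainTmul G x' y')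
      (E.tensorEmbedding G iV iW u) =
    pairing (E.vectorFunctional x x' ∘ₗ iV) (G.vectorFunctional y y' ∘ₗ iW) u := by
  induction u with
  | zero => simp
  | tmul v w =>
    rw [pairing_tmul, tensorEmbedding_tmul, vectorFunctional_apply, Submodule.coe_inner, domainTmul,
      domainTmul, tensorOp_htmul, inner_htmul]
    rfl
  | add a b ha hb => simp only [map_add, ha, hb]

/-- The difference of the two values at `x' ⊗ y'` stays in one `H_α ⊗ K_β` and is orthogonal to the
elementary tensors spanning it densely, hence to itself. -/
lemma eq_of_vectorFunctional_domainTmul {S T : (E.tensor G).starAlg}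
    (h : ∀ x x' y y', (E.tensor G).vectorFunctional (E.domainTmul G x y) (E.domainTmul G x' y') S =
      (E.tensor G).vectorFunctional (E.domainTmul G x y) (E.domainTmul G x' y') T) : S = T := by
  refine tensor_ext E G fun x' y' => ?_
  obtain ⟨α, hα⟩ := E.mem_domain_iff.1 x'.2
  obtain ⟨β, hβ⟩ := G.mem_domain_iff.1 y'.2
  have hm : ∀ R : (E.tensor G).starAlg, ((R : Module.End ℂ (E.tensor G).domain)
      (E.domainTmul G x' y') : HilbertTensor H K) ∈ (E.tensor G).space (α, β) :=
    fun R => (E.tensor G).starAlg_mem_space R _ (htmul_mem hα hβ)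
  rw [← sub_eq_zero, ← inner_self_eq_zero (𝕜 := ℂ)]
  set z : HilbertTensor H K := _ - _ with hz
  have hmem : z ∈ tensorSpace (E.space α) (G.space β) := Submodule.sub_mem _ (hm S) (hm T)
  have := eq_on_tensorSpace (A := innerSL ℂ z) (B := 0) (fun x hx y hy => ?_) hmem
  · simpa using this
  · have h1 := h ⟨x, E.mem_domain hx⟩ x' ⟨y, G.mem_domain hy⟩ y'
    rw [vectorFunctional_apply, vectorFunctional_apply, Submodule.coe_inner, Submodule.coe_inner,
      ← sub_eq_zero, ← inner_sub_right] at h1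
    rw [innerSL_apply_apply, zero_apply, ← inner_conj_symm]
    exact (congrArg (starRingEnd ℂ) h1).trans (map_zero _)

/-- Vector functionals separate the points of each factor. Injectivity of `iW` kills every slice by
a vector functional on `V`; injectivity of `iV` then kills the slices by arbitrary functionals on
`W`. -/
lemma tensorEmbedding_injective (hV : Function.Injective iV) (hW : Function.Injective iW) :
    Function.Injective (E.tensorEmbedding G iV iW) := by
  rw [injective_iff_map_eq_zero]
  intro u hu
  have hpair : ∀ x x' y y',
      pairing (E.vectorFunctional x x' ∘ₗ iV) (G.vectorFunctional y y' ∘ₗ iW) u = 0 := by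
    intro x x' y y'
    rw [← vectorFunctional_tensorEmbedding, hu, map_zero]
  have hleft : ∀ x x', sliceLeft W (E.vectorFunctional x x' ∘ₗ iV) u = 0 := by
    intro x x'
    refine (injective_iff_map_eq_zero iW).1 hW _ (G.eq_zero_of_vectorFunctional fun y y' => ?_)
    exact (apply_sliceLeft _ (G.vectorFunctional y y' ∘ₗ iW) u).trans (hpair x x' y y')
  refine eq_zero_of_sliceRight fun g => ?_
  refine (injective_iff_map_eq_zero iV).1 hV _ (E.eq_zero_of_vectorFunctional fun x x' => ?_)
  refine (apply_sliceRight (E.vectorFunctional x x' ∘ₗ iV) g u).trans ?_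
  rw [← apply_sliceLeft, hleft, map_zero]

lemma tensorEmbedding_unit {eV : V} {eW : W} (hV : iV eV = 1) (hW : iW eW = 1) :
    E.tensorEmbedding G iV iW (eV ⊗ₜ eW) = 1 := by
  refine tensor_ext E G fun x y => ?_
  rw [tensorEmbedding_tmul, tensorOp_htmul, hV, hW]
  rfl

/-- The same form as for LUCP maps, now with vector functionals, so spatial positivity and `lmin`
positivity become comparable. -/
lemma quadForm_tensorEmbedding {n ι κ : Type*} [Fintype n] [Fintype ι] [Fintype κ]
    (A : Matrix n n (V ⊗[ℂ] W)) (c : n → ι → κ → ℂ) (ξ : ι → E.domain) (η : κ → G.domain) :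
    (E.tensor G).quadForm (A.map (E.tensorEmbedding G iV iW))
      (fun i => ∑ a, ∑ b, c i a b • E.domainTmul G (ξ a) (η b)) =
    pairingForm (fun a a' => E.vectorFunctional (ξ a) (ξ a') ∘ₗ iV)
      (fun b b' => G.vectorFunctional (η b) (η b') ∘ₗ iW) c A := by
  simp only [quadForm, pairingForm, ← vectorFunctional_tensorEmbedding, Matrix.map_apply]
  refine Finset.sum_congr rfl fun i _ => Finset.sum_congr rfl fun j _ => ?_
  generalize E.tensorEmbedding G iV iW (A i j) = T
  simp only [vectorFunctional_apply, map_sum, map_smul, sum_inner, inner_sum, inner_smul_left,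
    inner_smul_right, Finset.mul_sum]
  simp only [← Finset.sum_product']
  refine Finset.sum_bij' (fun x _ => (x.2.2.1, x.2.2.2, x.1, x.2.1))
    (fun y _ => (y.2.2.1, y.2.2.2, y.1, y.2.1)) ?_ ?_ ?_ ?_ ?_ <;>
  simp [mul_assoc, mul_left_comm]

variable [StarAddMonoid V] [StarModule ℂ V] [StarAddMonoid W] [StarModule ℂ W]

lemma tensorEmbedding_star (hV : ∀ v, iV (star v) = star (iV v))
    (hW : ∀ w, iW (star w) = star (iW w)) (u : V ⊗[ℂ] W) :
    E.tensorEmbedding G iV iW (star u) = star (E.tensorEmbedding G iV iW u) := by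
  refine E.eq_of_vectorFunctional_domainTmul G fun x x' y y' => ?_
  rw [vectorFunctional_star, vectorFunctional_tensorEmbedding, vectorFunctional_tensorEmbedding]
  refine pairing_star (fun v => ?_) (fun w => ?_) u
  · rw [LinearMap.comp_apply, hV, vectorFunctional_star, LinearMap.comp_apply]
  · rw [LinearMap.comp_apply, hW, vectorFunctional_star, LinearMap.comp_apply]

end TensorEmbedding

/-! ### LUCP maps from finite orthonormal systems. -/

section Compression

variable {Γ V H : Type*} [AddCommGroup V] [Module ℂ V] [StarAddMonoid V] [StarModule ℂ V]
  [NormedAddCommGroup H] [InnerProductSpace ℂ H] [CompleteSpace H]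

/-- The map `v ↦ (⟨ξ_a, i(v) ξ_b⟩)_{a b}`. -/
noncomputable def compression (E : QuantizedDomain Γ H) (i : V →ₗ[ℂ] E.starAlg) {ι : Type*}
    (ξ : ι → E.domain) : V →ₗ[ℂ] Matrix ι ι ℂ where
  toFun v := Matrix.of fun a b => E.vectorFunctional (ξ a) (ξ b) (i v)
  map_add' v w := by
    ext a b
    simp only [map_add, Matrix.add_apply, Matrix.of_apply]
  map_smul' c v := by
    ext a b
    simp only [map_smul, Matrix.smul_apply, Matrix.of_apply, RingHom.id_apply]

/-- Orthonormality makes the compression unital. Its block matrix at `x` has the value of the form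
of `i⁽ⁿ⁾(A)` at the vectors `∑ x (j, a) • ξ a`, which lie in `H_α`. -/
lemma isLUCP_compression {C : Γ → ∀ n : ℕ, Set (Matrix (Fin n) (Fin n) V)} {e : V}
    {E : QuantizedDomain Γ H} {i : V →ₗ[ℂ] E.starAlg} (hi : E.IsLocalOrderEmbedding C e i)
    {α : Γ} {ι : Type*} [Fintype ι] [DecidableEq ι] {ξ : ι → E.domain} (hξ : Orthonormal ℂ ξ)
    (hmem : ∀ a, (ξ a : H) ∈ E.space α) : IsLUCP (C α) e (E.compression i ξ) where
  map_unit := by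
    ext a b
    change E.vectorFunctional (ξ a) (ξ b) (i e) = _
    rw [hi.map_unit, Matrix.one_apply]
    exact orthonormal_iff_ite.1 hξ a b
  posSemidef n A hA := by
    rw [hi.cone_eq] at hA
    refine Matrix.posSemidef_iff_dotProduct_mulVec.2 ⟨?_, fun x => ?_⟩
    · ext s t
      change star (E.vectorFunctional (ξ t.2) (ξ s.2) (i (A t.1 s.1))) =
        E.vectorFunctional (ξ s.2) (ξ t.2) (i (A s.1 t.1))
      rw [← vectorFunctional_star]
      exact congrArg _ (hA.1.apply s.1 t.1)
    · have h := (E.mem_cone_iff.1 hA).2 (fun j => ∑ a, x (j, a) • ξ a) fun j => by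
        rw [Submodule.coe_sum]
        exact Submodule.sum_mem _ fun a _ => Submodule.smul_mem _ _ (hmem a)
      convert h using 1
      simp only [quadForm, dotProduct, Matrix.mulVec, Matrix.comp_apply, Matrix.map_apply,
        compression, LinearMap.coe_mk, AddHom.coe_mk, Matrix.of_apply, Fintype.sum_prod_type,
        vectorFunctional_apply, map_sum, map_smul, sum_inner, inner_sum, inner_smul_left,
        inner_smul_right, Finset.mul_sum, Pi.star_apply]
      simp only [← Finset.sum_product']
      refine Finset.sum_bij' (fun x _ => (x.1, x.2.2.1, x.2.2.2, x.2.1))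
        (fun y _ => (y.1, y.2.2.2, y.2.1, y.2.2.1)) ?_ ?_ ?_ ?_ ?_ <;>
      simp [mul_left_comm, mul_comm]

end Compression

end QuantizedDomain

end LocalOpSys

namespace LocalOpSys

namespace QuantizedDomain

/-! ### Algebraic tensors inside the Hilbert space tensor product. -/

section HilbertTensor

variable {H K : Type*} [NormedAddCommGroup H] [InnerProductSpace ℂ H]
  [NormedAddCommGroup K] [InnerProductSpace ℂ K]

/-- The algebraic span of the elementary tensors `x ⊗ y` with `x ∈ X` and `y ∈ Y`. -/
noncomputable def tmulSpan (X : Submodule ℂ H) (Y : Submodule ℂ K) :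
    Submodule ℂ (HilbertTensor H K) :=
  Submodule.span ℂ {z | ∃ x ∈ X, ∃ y ∈ Y, z = htmul x y}

lemma tmulSpan_mono {X X' : Submodule ℂ H} {Y Y' : Submodule ℂ K} (hX : X ≤ X') (hY : Y ≤ Y') :
    tmulSpan X Y ≤ tmulSpan X' Y' := by
  refine Submodule.span_mono ?_
  rintro _ ⟨x, hx, y, hy, rfl⟩
  exact ⟨x, hX hx, y, hY hy, rfl⟩

/-- Passing to finite-dimensional subspaces makes finite orthonormal bases available. -/
lemma exists_finiteDimensional_mem_tmulSpan {X : Submodule ℂ H} {Y : Submodule ℂ K}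
    {z : HilbertTensor H K} (hz : z ∈ tmulSpan X Y) :
    ∃ X₀ ≤ X, ∃ Y₀ ≤ Y, FiniteDimensional ℂ X₀ ∧ FiniteDimensional ℂ Y₀ ∧ z ∈ tmulSpan X₀ Y₀ := by
  induction hz using Submodule.span_induction with
  | mem z hz =>
    obtain ⟨x, hx, y, hy, rfl⟩ := hz
    exact ⟨ℂ ∙ x, (Submodule.span_singleton_le_iff_mem _ _).2 hx, ℂ ∙ y,
      (Submodule.span_singleton_le_iff_mem _ _).2 hy, inferInstance, inferInstance,
      Submodule.subset_span ⟨x, Submodule.mem_span_singleton_self x, y,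
        Submodule.mem_span_singleton_self y, rfl⟩⟩
  | zero =>
    exact ⟨⊥, bot_le, ⊥, bot_le, inferInstance, inferInstance, Submodule.zero_mem _⟩
  | add a b _ _ ha hb =>
    obtain ⟨X₁, hX₁, Y₁, hY₁, _, _, h₁⟩ := ha
    obtain ⟨X₂, hX₂, Y₂, hY₂, _, _, h₂⟩ := hb
    exact ⟨X₁ ⊔ X₂, sup_le hX₁ hX₂, Y₁ ⊔ Y₂, sup_le hY₁ hY₂, inferInstance, inferInstance,
      Submodule.add_mem _ (tmulSpan_mono le_sup_left le_sup_left h₁)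
        (tmulSpan_mono le_sup_right le_sup_right h₂)⟩
  | smul c a _ ha =>
    obtain ⟨X₁, hX₁, Y₁, hY₁, h1, h2, h₁⟩ := ha
    exact ⟨X₁, hX₁, Y₁, hY₁, h1, h2, Submodule.smul_mem _ c h₁⟩

/-- The elementary tensor as a bilinear map. -/
noncomputable def htmulₗ (H K : Type*) [NormedAddCommGroup H] [InnerProductSpace ℂ H]
    [NormedAddCommGroup K] [InnerProductSpace ℂ K] : H →ₗ[ℂ] K →ₗ[ℂ] HilbertTensor H K :=
  (TensorProduct.mk ℂ H K).compr₂
    (UniformSpace.Completion.toComplL (𝕜 := ℂ) (E := H ⊗[ℂ] K)).toLinearMap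

/-- Finitely many vectors in the algebraic tensor product of `X` and `Y` are combinations of
elementary tensors built from two orthonormal systems. -/
lemma exists_orthonormal_of_mem_tmulSpan {X : Submodule ℂ H} {Y : Submodule ℂ K}
    {n : Type*} [Finite n] {z : n → HilbertTensor H K} (hz : ∀ i, z i ∈ tmulSpan X Y) :
    ∃ (k m : ℕ) (ξ : Fin k → H) (η : Fin m → K), Orthonormal ℂ ξ ∧ Orthonormal ℂ η ∧
      (∀ a, ξ a ∈ X) ∧ (∀ b, η b ∈ Y) ∧ ∃ c : n → Fin k → Fin m → ℂ,
        ∀ i, z i = ∑ a, ∑ b, c i a b • htmul (ξ a) (η b) := by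
  choose X₀ hX₀ Y₀ hY₀ hfX hfY hmem using fun i => exists_finiteDimensional_mem_tmulSpan (hz i)
  -- A finite supremum of the subspaces lets one pair of orthonormal bases serve all the `z i`.
  have : FiniteDimensional ℂ (⨆ i, X₀ i : Submodule ℂ H) := Submodule.finiteDimensional_iSup X₀
  have : FiniteDimensional ℂ (⨆ i, Y₀ i : Submodule ℂ K) := Submodule.finiteDimensional_iSup Y₀
  let b := stdOrthonormalBasis ℂ (⨆ i, X₀ i : Submodule ℂ H)
  let d := stdOrthonormalBasis ℂ (⨆ i, Y₀ i : Submodule ℂ K)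
  have hspan : ∀ i, z i ∈ Submodule.span ℂ (Set.range fun p : Fin _ × Fin _ =>
      (htmul (b p.1 : H) (d p.2 : K) : HilbertTensor H K)) := by
    intro i
    refine (Submodule.span_le.2 ?_ : tmulSpan (⨆ i, X₀ i) (⨆ i, Y₀ i) ≤ _)
      (tmulSpan_mono (le_iSup X₀ i) (le_iSup Y₀ i) (hmem i))
    rintro _ ⟨x, hx, y, hy, rfl⟩
    have hx' : x = ∑ a, b.repr ⟨x, hx⟩ a • (b a : H) := by
      simpa using congrArg Subtype.val (b.sum_repr ⟨x, hx⟩).symm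
    have hy' : y = ∑ a, d.repr ⟨y, hy⟩ a • (d a : K) := by
      simpa using congrArg Subtype.val (d.sum_repr ⟨y, hy⟩).symm
    change htmulₗ H K x y ∈ _
    rw [hx', hy']
    simp only [map_sum, map_smul, LinearMap.sum_apply, LinearMap.smul_apply]
    exact Submodule.sum_mem _ fun _ _ => Submodule.smul_mem _ _ <| Submodule.sum_mem _ fun _ _ =>
      Submodule.smul_mem _ _ (Submodule.subset_span ⟨(_, _), rfl⟩)
  choose c hc using fun i => (Submodule.mem_span_range_iff_exists_fun ℂ).1 (hspan i)
  refine ⟨_, _, fun a => (b a : H), fun a => (d a : K), ?_, ?_, fun a => ?_, fun a => ?_,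
    fun i a a' => c i (a, a'), fun i => ?_⟩
  · exact b.orthonormal.comp_linearIsometry (Submodule.subtypeₗᵢ _)
  · exact d.orthonormal.comp_linearIsometry (Submodule.subtypeₗᵢ _)
  · exact (iSup_le hX₀ : (⨆ i, X₀ i) ≤ X) (b a).2
  · exact (iSup_le hY₀ : (⨆ i, Y₀ i) ≤ Y) (d a).2
  · rw [← hc i, Fintype.sum_prod_type]

/-- The tensor product `f ⊗ g` of two isometries between Hilbert spaces. -/
lemma exists_linearIsometry_htmul {H' K' : Type*} [NormedAddCommGroup H'] [InnerProductSpace ℂ H']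
    [NormedAddCommGroup K'] [InnerProductSpace ℂ K'] (f : H' →ₗᵢ[ℂ] H) (g : K' →ₗᵢ[ℂ] K) :
    ∃ J : HilbertTensor H' K' →ₗᵢ[ℂ] HilbertTensor H K,
      ∀ x y, J (htmul x y) = htmul (f x) (g y) := by
  let j : H' ⊗[ℂ] K' →ₗᵢ[ℂ] H ⊗[ℂ] K := TensorProduct.mapIsometry f g
  let J : HilbertTensor H' K' →L[ℂ] HilbertTensor H K := j.toContinuousLinearMap.completion
  have hJ : Isometry J := j.isometry.completion_map
  refine ⟨⟨J.toLinearMap, hJ.norm_map_of_map_zero (map_zero J)⟩, fun x y => ?_⟩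
  change J ((x ⊗ₜ[ℂ] y : H' ⊗[ℂ] K') : HilbertTensor H' K') = _
  rw [ContinuousLinearMap.completion_apply_coe]
  rfl

/-- The subspace `X ⊗ Y` of `H ⊗ K` is the Hilbert space tensor product of `X` and `Y`. -/
lemma exists_linearIsometryEquiv_tensorSpace (X : Submodule ℂ H) (Y : Submodule ℂ K) :
    ∃ U : HilbertTensor X Y ≃ₗᵢ[ℂ] tensorSpace X Y,
      ∀ x y, (U (htmul x y) : HilbertTensor H K) = htmul (x : H) (y : K) := by
  obtain ⟨J, hJ⟩ := exists_linearIsometry_htmul X.subtypeₗᵢ Y.subtypeₗᵢ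
  -- The range of an isometry on a complete space is closed, so elementary tensors decide both
  -- inclusions.
  have hrange : J.toLinearMap.range = tensorSpace X Y := by
    refine le_antisymm ?_ (tensorSpace_le_of_forall ?_ fun x hx y hy => ?_)
    · rintro _ ⟨z, rfl⟩
      refine tensorSpace_le_of_forall (S := (tensorSpace X Y).comap J.toLinearMap)
        (IsClosed.preimage J.continuous (Submodule.isClosed_topologicalClosure _))
        (fun x _ y _ => ?_) (mem_tensorSpace_top z)
      change J (htmul x y) ∈ tensorSpace X Y
      rw [hJ]
      exact htmul_mem x.2 y.2
    · exact J.isometry.isClosedEmbedding.isClosed_range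
    · exact ⟨htmul ⟨x, hx⟩ ⟨y, hy⟩, hJ _ _⟩
  exact ⟨J.equivRange.trans (LinearIsometryEquiv.ofEq _ _ hrange), hJ⟩

end HilbertTensor

/-! ### Equality of the `lmin` cones and the spatial cones. -/

section Lmin

variable {Γ Λ V W H K : Type*}
  [AddCommGroup V] [Module ℂ V] [StarAddMonoid V] [StarModule ℂ V]
  [AddCommGroup W] [Module ℂ W] [StarAddMonoid W] [StarModule ℂ W]
  [NormedAddCommGroup H] [InnerProductSpace ℂ H] [CompleteSpace H]
  [NormedAddCommGroup K] [InnerProductSpace ℂ K] [CompleteSpace K]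
  {C : Γ → ∀ n : ℕ, Set (Matrix (Fin n) (Fin n) V)} {eV : V}
  {D : Λ → ∀ n : ℕ, Set (Matrix (Fin n) (Fin n) W)} {eW : W}
  {E : QuantizedDomain Γ H} {G : QuantizedDomain Λ K}
  {iV : V →ₗ[ℂ] E.starAlg} {iW : W →ₗ[ℂ] G.starAlg}

/-- Entry functionals are replaced by vector functionals one factor at a time, first on `V` through
`φ` and `iV`, then on `W` through `ψ` and `iW`. -/
lemma inducedCone_subset_lminCone (hV : IsLocalOperatorSystem C eV)
    (hW : IsLocalOperatorSystem D eW) (hiV : E.IsLocalOrderEmbedding C eV iV)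
    (hiW : G.IsLocalOrderEmbedding D eW iW) (α : Γ) (β : Λ) (n : ℕ) :
    (E.tensor G).inducedCone (E.tensorEmbedding G iV iW) (α, β) n ⊆
      lminCone C eV D eW (α, β) n := by
  intro A hA
  have hVs := map_star_of_isLocalOrderEmbedding hV hiV
  have hWs := map_star_of_isLocalOrderEmbedding hW hiW
  have hAh : A.IsHermitian := (isHermitian_map_iff
    (E.tensorEmbedding_injective G iV iW hiV.injective hiW.injective)
    (E.tensorEmbedding_star G iV iW hVs hWs)).1 hA.1
  refine ⟨hAh, fun k m φ ψ hφ hψ => Matrix.posSemidef_iff_dotProduct_mulVec.2 ⟨?_, fun x => ?_⟩⟩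
  · ext s t
    have h := tensorMatrixMap_star (IsLUCP.map_star hV hφ) (IsLUCP.map_star hW hψ) (A t.1 s.1)
    rw [hAh.apply] at h
    exact (congrFun₂ h s.2 t.2).symm
  · rw [dotProduct_comp_tensorMatrixMap, ← sum_apply_matrixSliceRight]
    refine hφ.sum_nonneg ?_
    rw [hiV.cone_eq]
    refine E.mem_cone_iff.2 ⟨?_, fun ξ hξ => ?_⟩
    · rw [isHermitian_map_iff hiV.injective hVs]
      exact isHermitian_matrixSliceRight
        (fun b b' w => congrFun₂ (IsLUCP.map_star hW hψ w) b b') _ hAh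
    -- The form now has vector functionals on `V` and entries of `ψ` on `W`; slicing the other way
    -- brings `ψ` into play.
    · refine le_of_le_of_eq ?_ (sum_apply_matrixSliceRight
        (fun a a' => E.vectorFunctional (ξ a) (ξ a') ∘ₗ iV) _ _ A).symm
      rw [← sum_apply_matrixSliceLeft]
      refine hψ.sum_nonneg ?_
      rw [hiW.cone_eq]
      refine G.mem_cone_iff.2 ⟨?_, fun η hη => ?_⟩
      · rw [isHermitian_map_iff hiW.injective hWs]
        refine isHermitian_matrixSliceLeft (fun a a' v => ?_) _ hAh
        rw [LinearMap.comp_apply, hVs, vectorFunctional_star, LinearMap.comp_apply]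
      · refine le_of_le_of_eq ?_ (sum_apply_matrixSliceLeft _
          (fun b b' => G.vectorFunctional (η b) (η b') ∘ₗ iW) _ A).symm
        -- With vector functionals on both sides the form is that of `(iV ⊗ iW)⁽ⁿ⁾(A)` at vectors of
        -- `H_α ⊗ K_β`.
        rw [← quadForm_tensorEmbedding]
        refine ((E.tensor G).mem_cone_iff.1 hA).2 _ fun i => ?_
        simp only [Submodule.coe_sum, Submodule.coe_smul]
        exact Submodule.sum_mem _ fun a _ => Submodule.sum_mem _ fun b _ =>
          Submodule.smul_mem _ _ (htmul_mem (hξ a) (hη b))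

/-- Compressions to orthonormal systems give positivity on algebraic tensors, which are dense in
`H_α ⊗ K_β`. -/
lemma lminCone_subset_inducedCone (hV : IsLocalOperatorSystem C eV)
    (hW : IsLocalOperatorSystem D eW) (hiV : E.IsLocalOrderEmbedding C eV iV)
    (hiW : G.IsLocalOrderEmbedding D eW iW) (α : Γ) (β : Λ) (n : ℕ) :
    lminCone C eV D eW (α, β) n ⊆
      (E.tensor G).inducedCone (E.tensorEmbedding G iV iW) (α, β) n := by
  intro A hA
  have hVs := map_star_of_isLocalOrderEmbedding hV hiV
  have hWs := map_star_of_isLocalOrderEmbedding hW hiW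
  refine (E.tensor G).mem_cone_iff.2 ⟨?_, fun ζ hζ => ?_⟩
  · rw [isHermitian_map_iff (E.tensorEmbedding_injective G iV iW hiV.injective hiW.injective)
      (E.tensorEmbedding_star G iV iW hVs hWs)]
    exact hA.1
  -- The bounded operators `cut` agree with the entries on `H_α ⊗ K_β` and are defined on all of `H
  -- ⊗ K`, so the positivity condition is closed.
  let S : Set (Fin n → HilbertTensor H K) := {z | 0 ≤ ∑ i, ∑ j,
    ⟪z i, (E.tensor G).cut (E.tensorEmbedding G iV iW (A i j)) (α, β) (z j)⟫_ℂ}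
  have hS : IsClosed S := isClosed_le continuous_const (by fun_prop)
  have hcut : ∀ ω : Fin n → (E.tensor G).domain,
      (∀ i, (ω i : HilbertTensor H K) ∈ (E.tensor G).space (α, β)) →
      ((fun i => (ω i : HilbertTensor H K)) ∈ S ↔
        0 ≤ (E.tensor G).quadForm (A.map (E.tensorEmbedding G iV iW)) ω) := by
    intro ω hω
    have h : ∀ i j, (E.tensor G).cut (E.tensorEmbedding G iV iW (A i j)) (α, β) (ω j) =
        (((E.tensorEmbedding G iV iW (A i j) : (E.tensor G).starAlg) :
          Module.End ℂ (E.tensor G).domain) (ω j) : HilbertTensor H K) :=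
      fun i j => (E.tensor G).cut_of_mem _ _ (hω j)
    simp only [S, Set.mem_ofPred_eq, h]
    rfl
  rw [← hcut ζ hζ]
  have hclosure : (fun i => (ζ i : HilbertTensor H K)) ∈ closure (Set.univ.pi fun _ : Fin n =>
      (tmulSpan (E.space α) (G.space β) : Set (HilbertTensor H K))) := by
    rw [closure_pi_set]
    exact fun i _ => hζ i
  refine closure_minimal (fun z hz => ?_) hS hclosure
  obtain ⟨k, m, ξ, η, hξ, hη, hξm, hηm, c, hc⟩ :=
    exists_orthonormal_of_mem_tmulSpan fun i => hz i (Set.mem_univ i)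
  let ξ' : Fin k → E.domain := fun a => ⟨ξ a, E.mem_domain (hξm a)⟩
  let η' : Fin m → G.domain := fun b => ⟨η b, G.mem_domain (hηm b)⟩
  have hpos := (hA.2 k m _ _ (isLUCP_compression hiV (ξ := ξ') hξ hξm)
    (isLUCP_compression hiW (ξ := η') hη hηm)).dotProduct_mulVec_nonneg
    fun s => c s.1 s.2.1 s.2.2
  rw [dotProduct_comp_tensorMatrixMap] at hpos
  have hz' : z = fun i => ((∑ a, ∑ b, c i a b • E.domainTmul G (ξ' a) (η' b) :
      (E.tensor G).domain) : HilbertTensor H K) := by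
    funext i
    simp only [hc i, Submodule.coe_sum, Submodule.coe_smul]
    rfl
  rw [hz', hcut _ fun i => ?_]
  · rw [quadForm_tensorEmbedding]
    exact hpos
  · simp only [Submodule.coe_sum, Submodule.coe_smul]
    exact Submodule.sum_mem _ fun a _ => Submodule.sum_mem _ fun b _ =>
      Submodule.smul_mem _ _ (htmul_mem (hξm a) (hηm b))

end Lmin

end QuantizedDomain

/-! ### Tensor products of positive matrices and of LUCP maps. -/

section TensorStructure

variable {Γ Λ V W : Type*}
  [AddCommGroup V] [Module ℂ V] [StarAddMonoid V] [StarModule ℂ V]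
  [AddCommGroup W] [Module ℂ W] [StarAddMonoid W] [StarModule ℂ W]
  {C : Γ → ∀ n : ℕ, Set (Matrix (Fin n) (Fin n) V)} {eV : V}
  {D : Λ → ∀ n : ℕ, Set (Matrix (Fin n) (Fin n) W)} {eW : W}

/-- After regrouping indices, `(φ ⊗ ψ)` of `P ⊗ Q` is the Kronecker product of the positive matrices
`φ⁽ⁿ⁾(P)` and `ψ⁽ᵐ⁾(Q)`. -/
lemma matrixTensor_mem_lminCone (hV : IsLocalOperatorSystem C eV)
    (hW : IsLocalOperatorSystem D eW) {α : Γ} {β : Λ} {n m : ℕ} {P : Matrix (Fin n) (Fin n) V}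
    (hP : P ∈ C α n) {Q : Matrix (Fin m) (Fin m) W} (hQ : Q ∈ D β m) :
    matrixTensor P Q ∈ lminCone C eV D eW (α, β) (n * m) := by
  refine ⟨?_, fun k l φ ψ hφ hψ => ?_⟩
  · ext i j
    simp only [matrixTensor, Matrix.conjTranspose_apply, Matrix.reindex_apply,
      Matrix.submatrix_apply, Matrix.kroneckerMap_apply, TensorProduct.star_tmul,
      (hV.isHermitian α n P hP).apply, (hW.isHermitian β m Q hQ).apply]
  · refine ((hφ.posSemidef n P hP).kronecker (hψ.posSemidef m Q hQ)).submatrix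
      fun s : Fin (n * m) × Fin k × Fin l =>
        (((finProdFinEquiv.symm s.1).1, s.2.1), ((finProdFinEquiv.symm s.1).2, s.2.2))

lemma isLUCP_tensorMatrixMap {α : Γ} {β : Λ} {k m : ℕ} {φ : V →ₗ[ℂ] Matrix (Fin k) (Fin k) ℂ}
    {ψ : W →ₗ[ℂ] Matrix (Fin m) (Fin m) ℂ} (hφ : IsLUCP (C α) eV φ) (hψ : IsLUCP (D β) eW ψ) :
    IsLUCP (lminCone C eV D eW (α, β)) (eV ⊗ₜ[ℂ] eW) (tensorMatrixMap φ ψ) where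
  map_unit := by
    rw [tensorMatrixMap_tmul, hφ.map_unit, hψ.map_unit, Matrix.one_kronecker_one]
  posSemidef _ _ hA := hA.2 k m φ ψ hφ hψ

end TensorStructure

end LocalOpSys

/-! ### The main theorem. -/

theorem mainTheorem7 {Γ Λ V W H K : Type*}
    [AddCommGroup V] [Module ℂ V] [StarAddMonoid V] [StarModule ℂ V]
    [AddCommGroup W] [Module ℂ W] [StarAddMonoid W] [StarModule ℂ W]
    [NormedAddCommGroup H] [InnerProductSpace ℂ H] [CompleteSpace H]
    [NormedAddCommGroup K] [InnerProductSpace ℂ K] [CompleteSpace K]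
    (C : Γ → ∀ n : ℕ, Set (Matrix (Fin n) (Fin n) V)) (eV : V)
    (D : Λ → ∀ n : ℕ, Set (Matrix (Fin n) (Fin n) W)) (eW : W)
    (hV : LocalOpSys.IsLocalOperatorSystem C eV)
    (hW : LocalOpSys.IsLocalOperatorSystem D eW)
    (E : LocalOpSys.QuantizedDomain Γ H) (G : LocalOpSys.QuantizedDomain Λ K)
    (iV : V →ₗ[ℂ] E.starAlg) (iW : W →ₗ[ℂ] G.starAlg)
    (hiV : E.IsLocalOrderEmbedding C eV iV) (hiW : G.IsLocalOrderEmbedding D eW iW) :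
    -- the `lmin` cones are the spatial cones induced by `iV ⊗ iW`
    (∀ α β n, LocalOpSys.lminCone C eV D eW (α, β) n =
      (E.tensor G).inducedCone (E.tensorEmbedding G iV iW) (α, β) n) ∧
    -- `iV ⊗ iW` is a `*`-preserving local unital complete order isomorphism onto its range
    (E.tensor G).IsLocalOrderEmbedding (LocalOpSys.lminCone C eV D eW) (eV ⊗ₜ[ℂ] eW)
      (E.tensorEmbedding G iV iW) ∧
    (∀ u, E.tensorEmbedding G iV iW (star u) = star (E.tensorEmbedding G iV iW u)) ∧
    -- the `lmin` cones are a local operator system structure on `V ⊗ W`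
    LocalOpSys.IsTensorStructure C eV D eW (LocalOpSys.lminCone C eV D eW) ∧
    -- the domain `D ⊗ F` of `C*_{E × G}(D ⊗ F)` is the union of the `H_α ⊗ K_β`
    (((E.tensor G).domain : Set (LocalOpSys.QuantizedDomain.HilbertTensor H K)) =
      ⋃ p : Γ × Λ, ((E.tensor G).space p : Set (LocalOpSys.QuantizedDomain.HilbertTensor H K))) ∧
    (∀ α β, ∃ U : LocalOpSys.QuantizedDomain.HilbertTensor (E.space α) (G.space β) ≃ₗᵢ[ℂ]
        (E.tensor G).space (α, β),
      ∀ x y, (U (LocalOpSys.QuantizedDomain.htmul x y) :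
        LocalOpSys.QuantizedDomain.HilbertTensor H K) =
          LocalOpSys.QuantizedDomain.htmul (x : H) (y : K)) := by
  have hcone : ∀ α β n, LocalOpSys.lminCone C eV D eW (α, β) n =
      (E.tensor G).inducedCone (E.tensorEmbedding G iV iW) (α, β) n := fun α β n =>
    Set.Subset.antisymm
      (LocalOpSys.QuantizedDomain.lminCone_subset_inducedCone hV hW hiV hiW α β n)
      (LocalOpSys.QuantizedDomain.inducedCone_subset_lminCone hV hW hiV hiW α β n)
  have hinj := E.tensorEmbedding_injective G iV iW hiV.injective hiW.injective
  have hunit := E.tensorEmbedding_unit G iV iW hiV.map_unit hiW.map_unit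
  have hstar := E.tensorEmbedding_star G iV iW
    (LocalOpSys.QuantizedDomain.map_star_of_isLocalOrderEmbedding hV hiV)
    (LocalOpSys.QuantizedDomain.map_star_of_isLocalOrderEmbedding hW hiW)
  refine ⟨hcone, ⟨hinj, hunit, fun p n => hcone p.1 p.2 n⟩, hstar, ⟨?_, ?_, ?_, ?_⟩, ?_, ?_⟩
  -- The axioms are verified for the spatial cones and carried over by the equality of cones.
  · have h : LocalOpSys.lminCone C eV D eW =
        (E.tensor G).inducedCone (E.tensorEmbedding G iV iW) :=
      funext fun p => funext fun n => hcone p.1 p.2 n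
    rw [h]
    exact (E.tensor G).isLocalOperatorSystem_inducedCone _ hinj hstar hunit
  · exact fun α β => ⟨(α, β), fun n m P hP Q hQ =>
      LocalOpSys.matrixTensor_mem_lminCone hV hW hP hQ⟩
  · exact fun γ => ⟨γ.1, γ.2, fun n m P hP Q hQ =>
      LocalOpSys.matrixTensor_mem_lminCone hV hW hP hQ⟩
  · exact fun α β k m φ ψ hφ hψ => LocalOpSys.isLUCP_tensorMatrixMap hφ hψ
  · ext z
    rw [SetLike.mem_coe, (E.tensor G).mem_domain_iff, Set.mem_iUnion]
    rfl
  · exact fun α β =>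
      LocalOpSys.QuantizedDomain.exists_linearIsometryEquiv_tensorSpace (E.space α) (G.space β)
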